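/- Let $p\in\mathbb N$, let $H$ be a real $p\times p$ matrix all of whose (complex) eigenvalues have real part in $(0,1)\setminus\{1/2\}$, let $A$ be a complex $p\times p$ matrix, and put $D=H-\tfrac12 I$. For a real $p\times p$ matrix $M$ write $x_+^{M}=\exp((\log x)M)$ for $x>0$, $x_+^{M}=0$ for $x\le 0$, and $x_-^{M}=(-x)_+^{M}$. For $t\in\mathbb R$ let $$\widetilde g_t(x)=\frac{e^{\mathbf i tx}-1}{\mathbf i x}\bigl\{x_+^{-D}A+x_-^{-D}\overline A\bigr\},\qquad g_t=\mathcal F^{-1}(\widetilde g_t),$$ where $\mathcal F^{-1}$ is the entrywise unitary inverse Fourier transform on $L^2(\mathbb R)$, i.e. $\mathcal F^{-1}f(s)=(2\pi)^{-1/2}\int_{\mathbb R}e^{-\mathbf i sx}f(x)\,dx$; $g_t$ takes values in the real $p\times p$ matrices. For $\mathbb K\in\{\mathbb R,\mathbb C\}$ and a Lévy measure $\mu$ on $\mathbb K^p$ with $\mu(\{\mathbf 0\})=0$ and $\int\|\mathbf z\|^2\mu(d\mathbf z)<\infty$, let $N$ be a Poisson random measure on $\mathbb R\times\mathbb K^p$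 with intensity $dx\otimes\mu(d\mathbf z)$ and $\widetilde N=N-dx\otimes\mu(d\mathbf z)$; integrals with respect to $\widetilde N$ of square-integrable $\mathbb K^p$-valued functions are $L^2(\mathbb P)$-limits of integrals of finite linear combinations of indicators of measurable rectangles. A random vector is proper if its law is not concentrated on a proper subspace of $\mathbb R^p$. An orthogonal-increment random measure with control $dx\times I$ is an $L^2(\mathbb P)$-countably additive family of square-integrable $\mathbb K^p$-valued random vectors $\Phi(B)$, indexed by the Borel sets $B$ of finite Lebesgue measure $|B|$, such that $\mathbb E\,\Phi(B)\Phi(C)^*=0$ for disjoint $B,C$ and $\mathbb E\,\Phi(B)\Phi(B)^*=|B|\,I$; integrals of square-integrable matrix functions with respect to $\Phi$ are $L^2(\mathbb P)$-limits of integrals of step functions. (i) Let $X_H=\{X_H(t)\}_{t\in\mathbb R}$ be a moving average operator fractional Lévy motion (maofLm): an $\mathbb R^p$-valued process with $X_H(t)$ proper for every $t\neq0$ and $$\{X_H(t)\}_{t\in\mathbb R}\overset{\text{f.d.d.}}{=}\Bigl\{\int_{\mathbb R\times\mathbb R^p}g_t(s)\mathbf z\,\widetilde N(ds,d\mathbf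 z)\Bigr\}_{t\in\mathbb R},$$ where $\mu$ is a measure on $\mathbb R^p$ as above. If $\int_{\mathbb R^p}\mathbf z\mathbf z^*\mu(d\mathbf z)=I$, then there is a $\mathbb C^p$-valued, zero mean orthogonal-increment random measure $\Phi_{\mathcal M}$ with $\mathbb E\,\Phi_{\mathcal M}(dx)\Phi_{\mathcal M}(dx)^*=dx\times I$, defined on the probability space of $N$, such that $$\{X_H(t)\}_{t\in\mathbb R}\overset{\text{f.d.d.}}{=}\Bigl\{\int_{\mathbb R}\widetilde g_t(x)\,\Phi_{\mathcal M}(dx)\Bigr\}_{t\in\mathbb R}.$$ (ii) Let $\widetilde X_H=\{\widetilde X_H(t)\}_{t\in\mathbb R}$ be a real harmonizable operator fractional Lévy motion (rhofLm): an $\mathbb R^p$-valued process with $\widetilde X_H(t)$ proper for every $t\neq0$ and $$\widetilde X_H(t)=\int_{\mathbb R\times\mathbb C^p}\bigl\{\widetilde g_t(x)\mathbf z+\widetilde g_t(-x)\overline{\mathbf z}\bigr\}\widetilde N(dx,d\mathbf z),\qquad t\in\mathbb R,$$ where $\mu$ is a measure on $\mathbb C^p$ as above. If $4\int_{\mathbb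 C^p}(\Re\mathbf z)(\Re\mathbf z)^*\mu(d\mathbf z)=I=4\int_{\mathbb C^p}(\Im\mathbf z)(\Im\mathbf z)^*\mu(d\mathbf z)$ and $\mu(d\mathbf z)=\mu(e^{\mathbf i\theta}d\mathbf z)$ for all $\theta\in[-\pi,\pi)$, then there is an $\mathbb R^p$-valued, zero mean orthogonal-increment random measure $\Phi_{\widetilde{\mathcal M}}$ with $\mathbb E\,\Phi_{\widetilde{\mathcal M}}(ds)\Phi_{\widetilde{\mathcal M}}(ds)^*=ds\times I$, defined on the probability space of $N$, such that $$\{\widetilde X_H(t)\}_{t\in\mathbb R}\overset{\text{f.d.d.}}{=}\Bigl\{\int_{\mathbb R}g_t(s)\,\Phi_{\widetilde{\mathcal M}}(ds)\Bigr\}_{t\in\mathbb R}.$$ -/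

import Mathlib

open MeasureTheory ProbabilityTheory Filter Topology
open scoped ENNReal FourierTransform Matrix

noncomputable section

namespace OfLm

/-! ### Linear algebra -/

/-- The action of a matrix on a vector of Euclidean space. -/
def matVec {𝕜 : Type*} [RCLike 𝕜] {p : ℕ} (M : Matrix (Fin p) (Fin p) 𝕜)
    (z : EuclideanSpace 𝕜 (Fin p)) : EuclideanSpace 𝕜 (Fin p) :=
  WithLp.toLp 2 (M *ᵥ z.ofLp)

/-- The inclusion `ℝᵖ ⊆ ℂᵖ`. -/
def toC {p : ℕ} (x : EuclideanSpace ℝ (Fin p)) : EuclideanSpace ℂ (Fin p) :=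
  WithLp.toLp 2 (fun i => (x i : ℂ))

/-- Entrywise complex conjugation on `ℂᵖ`. -/
def conjVec {p : ℕ} (z : EuclideanSpace ℂ (Fin p)) : EuclideanSpace ℂ (Fin p) :=
  WithLp.toLp 2 (fun i => (starRingEnd ℂ) (z i))

/-- `x₊^M = exp((log x) M)` for `x > 0`, and `0` for `x ≤ 0`.  The power `x₋^M` is `posPow (-x) M`. -/
def posPow {p : ℕ} (x : ℝ) (M : Matrix (Fin p) (Fin p) ℝ) : Matrix (Fin p) (Fin p) ℝ :=
  if 0 < x then NormedSpace.exp (Real.log x • M) else 0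

/-- The set of real parts of the (complex) eigenvalues of the real matrix `H`. -/
def reEig {p : ℕ} (H : Matrix (Fin p) (Fin p) ℝ) : Set ℝ :=
  Complex.re '' spectrum ℂ (H.map Complex.ofReal)

/-- The matrix `E[U V*]`, for random vectors `U` and `V`. -/
def crossMoment {𝕜 : Type*} [RCLike 𝕜] {p : ℕ} {Ω : Type*} [MeasurableSpace Ω] (P : Measure Ω)
    (U V : Ω → EuclideanSpace 𝕜 (Fin p)) : Matrix (Fin p) (Fin p) 𝕜 :=
  Matrix.of fun i j => ∫ ω, U ω i * (starRingEnd 𝕜) (V ω j) ∂P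

/-! ### Integration kernels -/

/-- The harmonizable kernel
`g̃_t(x) = ((e^{itx} - 1) / (ix)) (x₊^{-D} A + x₋^{-D} Ā)`, where `D = H - (1/2) I`. -/
def harmKernel {p : ℕ} (H : Matrix (Fin p) (Fin p) ℝ) (A : Matrix (Fin p) (Fin p) ℂ)
    (t x : ℝ) : Matrix (Fin p) (Fin p) ℂ :=
  ((Complex.exp (Complex.I * t * x) - 1) / (Complex.I * x)) •
    ((posPow x (-(H - (1 / 2 : ℝ) • 1))).map Complex.ofReal * A +
      (posPow (-x) (-(H - (1 / 2 : ℝ) • 1))).map Complex.ofReal * A.map (starRingEnd ℂ))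

open Classical in
/-- The unitary inverse Fourier transform `s ↦ (2π)^{-1/2} ∫ e^{-isx} f(x) dx` on `L²(ℝ)`,
obtained by rescaling the `L²` transform `ξ ↦ ∫ e^{-2πiξx} f(x) dx`. -/
def invFourierL2 (f : ℝ → ℂ) : ℝ → ℂ :=
  if hf : MemLp f 2 (volume : Measure ℝ) then
    fun s => ((Real.sqrt (2 * Real.pi))⁻¹ : ℝ) *
      (𝓕 (hf.toLp f) : Lp ℂ 2 (volume : Measure ℝ)) (s / (2 * Real.pi))
  else 0

/-- The moving average kernel, the entrywise inverse Fourier transform of the harmonizable kernel.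
It is real because the latter satisfies `g̃_t(-x) = conj (g̃_t(x))`. -/
def maKernel {p : ℕ} (H : Matrix (Fin p) (Fin p) ℝ) (A : Matrix (Fin p) (Fin p) ℂ)
    (t s : ℝ) : Matrix (Fin p) (Fin p) ℝ :=
  Matrix.of fun i j => (invFourierL2 (fun x => harmKernel H A t x i j) s).re

/-! ### Poisson random measures and their compensated integrals -/

/-- `N` is a Poisson random measure with intensity measure `ν`. -/
structure IsPoissonRandomMeasure {S Ω : Type*} [MeasurableSpace S] [MeasurableSpace Ω]
    (N : Ω → Measure S) (ν : Measure S) (P : Measure Ω) : Prop where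
  measurable : ∀ B, MeasurableSet B → Measurable fun ω => N ω B
  law : ∀ B, MeasurableSet B → ν B ≠ ∞ →
    P.map (fun ω => N ω B) =
      (poissonMeasure (ν B).toNNReal).map (fun k : ℕ => (k : ℝ≥0∞))
  law_top : ∀ B, MeasurableSet B → ν B = ∞ → ∀ᵐ ω ∂P, N ω B = ∞
  indep : ∀ (n : ℕ) (B : Fin n → Set S), (∀ i, MeasurableSet (B i)) →
    Pairwise (Function.onFun Disjoint B) → iIndepFun (fun i ω => N ω (B i)) P

/-- A Lévy measure without mass at the origin and with finite second moment. -/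
structure IsLevyL2 {𝕜 : Type*} [RCLike 𝕜] {p : ℕ}
    (μ : Measure (EuclideanSpace 𝕜 (Fin p))) : Prop where
  zero : μ {0} = 0
  secondMoment : ∫⁻ z, ‖z‖ₑ ^ 2 ∂μ < ∞

/-- A formal finite sum `∑ i, coef i · 1_{set i}` over measurable sets of finite measure. -/
structure StepFn (S : Type*) [MeasurableSpace S] (ν : Measure S) (W : Type*) where
  n : ℕ
  coef : Fin n → W
  set : Fin n → Set S
  measurableSet : ∀ i, MeasurableSet (set i)
  finite : ∀ i, ν (set i) ≠ ∞

/-- The function represented by a step function. -/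
def StepFn.eval {S : Type*} [MeasurableSpace S] {ν : Measure S} {W : Type*} [AddCommMonoid W]
    (f : StepFn S ν W) (x : S) : W :=
  ∑ i, (f.set i).indicator (fun _ => f.coef i) x

/-- The integral `∑ i, coef i · Ñ(set i)` of a step function with respect to the compensated
Poisson random measure `Ñ = N - ν`. -/
def StepFn.poissonInt {S Ω : Type*} [MeasurableSpace S] {ν : Measure S} {𝕜 : Type*} [RCLike 𝕜]
    {p : ℕ} (f : StepFn S ν (EuclideanSpace 𝕜 (Fin p))) (N : Ω → Measure S) (ω : Ω) :
    EuclideanSpace 𝕜 (Fin p) :=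
  ∑ i, (((N ω (f.set i)).toReal - (ν (f.set i)).toReal : ℝ) : 𝕜) • f.coef i

/-- `Y` is (a version of) the stochastic integral `∫ φ(x, z) Ñ(dx, dz)` of `φ ∈ L²(dx ⊗ μ)`:
the `L²(P)`-limit of the integrals of elementary functions, i.e. step functions over rectangles,
which converge to `φ` in `L²(dx ⊗ μ)`. -/
def IsPoissonIntegral {𝕜 : Type*} [RCLike 𝕜] {p : ℕ} {Ω : Type*} [MeasurableSpace Ω]
    (N : Ω → Measure (ℝ × EuclideanSpace 𝕜 (Fin p))) (μ : Measure (EuclideanSpace 𝕜 (Fin p)))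
    (P : Measure Ω) (φ : ℝ × EuclideanSpace 𝕜 (Fin p) → EuclideanSpace 𝕜 (Fin p))
    (Y : Ω → EuclideanSpace 𝕜 (Fin p)) : Prop :=
  MemLp φ 2 ((volume : Measure ℝ).prod μ) ∧ MemLp Y 2 P ∧
  ∃ F : ℕ → StepFn (ℝ × EuclideanSpace 𝕜 (Fin p)) ((volume : Measure ℝ).prod μ)
      (EuclideanSpace 𝕜 (Fin p)),
    (∀ k i, ∃ (B₁ : Set ℝ) (B₂ : Set (EuclideanSpace 𝕜 (Fin p))),
      MeasurableSet B₁ ∧ MeasurableSet B₂ ∧ (F k).set i = B₁ ×ˢ B₂) ∧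
    Tendsto (fun k => eLpNorm (fun w => (F k).eval w - φ w) 2 ((volume : Measure ℝ).prod μ))
      atTop (𝓝 0) ∧
    Tendsto (fun k => eLpNorm (fun ω => (F k).poissonInt N ω - Y ω) 2 P) atTop (𝓝 0)

/-! ### Orthogonal-increment random measures and their integrals -/

/-- `Φ` is a zero mean orthogonal-increment random measure with values in `𝕜ᵖ`, defined on the
Borel sets of finite Lebesgue measure, such that `E[Φ(dx) Φ(dx)*] = dx × I`. -/
structure IsOrthogonalRandomMeasure {𝕜 : Type*} [RCLike 𝕜] {p : ℕ} {Ω : Type*}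
    [MeasurableSpace Ω] (Φ : Set ℝ → Ω → EuclideanSpace 𝕜 (Fin p)) (P : Measure Ω) : Prop where
  memLp : ∀ B, MeasurableSet B → volume B ≠ ∞ → MemLp (Φ B) 2 P
  /-- Countable additivity in `L²(P)`. -/
  additive : ∀ B : ℕ → Set ℝ, (∀ n, MeasurableSet (B n)) → Pairwise (Function.onFun Disjoint B) →
    volume (⋃ n, B n) ≠ ∞ →
    Tendsto (fun n => eLpNorm (fun ω => (∑ k ∈ Finset.range n, Φ (B k) ω) - Φ (⋃ n, B n) ω) 2 P)
      atTop (𝓝 0)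
  mean_zero : ∀ B, MeasurableSet B → volume B ≠ ∞ → ∫ ω, Φ B ω ∂P = 0
  orthogonal : ∀ B C, MeasurableSet B → MeasurableSet C → volume B ≠ ∞ → volume C ≠ ∞ →
    Disjoint B C → crossMoment P (Φ B) (Φ C) = 0
  control : ∀ B, MeasurableSet B → volume B ≠ ∞ →
    crossMoment P (Φ B) (Φ B) = (((volume B).toReal : ℝ) : 𝕜) • 1

/-- The integral `∑ i, coef i Φ(set i)` of a matrix-valued step function. -/
def StepFn.orthInt {Ω : Type*} {𝕜 : Type*} [RCLike 𝕜] {p : ℕ}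
    (f : StepFn ℝ volume (Matrix (Fin p) (Fin p) 𝕜)) (Φ : Set ℝ → Ω → EuclideanSpace 𝕜 (Fin p))
    (ω : Ω) : EuclideanSpace 𝕜 (Fin p) :=
  ∑ i, matVec (f.coef i) (Φ (f.set i) ω)

/-- `Y` is (a version of) the integral `∫ f(x) Φ(dx)` of `f ∈ L²(ℝ, M(p, 𝕜))`, the `L²(P)`-limit of
the integrals of step functions which converge to `f` in `L²`. -/
def IsOrthIntegral {𝕜 : Type*} [RCLike 𝕜] {p : ℕ} {Ω : Type*} [MeasurableSpace Ω]
    (Φ : Set ℝ → Ω → EuclideanSpace 𝕜 (Fin p)) (P : Measure Ω)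
    (f : ℝ → Matrix (Fin p) (Fin p) 𝕜) (Y : Ω → EuclideanSpace 𝕜 (Fin p)) : Prop :=
  (∀ i j, MemLp (fun x => f x i j) 2 (volume : Measure ℝ)) ∧ MemLp Y 2 P ∧
  ∃ F : ℕ → StepFn ℝ volume (Matrix (Fin p) (Fin p) 𝕜),
    (∀ i j, Tendsto (fun k => eLpNorm (fun x => (F k).eval x i j - f x i j) 2
      (volume : Measure ℝ)) atTop (𝓝 0)) ∧
    Tendsto (fun k => eLpNorm (fun ω => (F k).orthInt Φ ω - Y ω) 2 P) atTop (𝓝 0)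

/-! ### Processes -/

/-- Equality of the finite-dimensional distributions of two processes indexed by `ℝ`. -/
def FddEq {Ω Ω' E : Type*} [MeasurableSpace Ω] [MeasurableSpace Ω'] [MeasurableSpace E]
    (X : ℝ → Ω → E) (P : Measure Ω) (Y : ℝ → Ω' → E) (P' : Measure Ω') : Prop :=
  ∀ (n : ℕ) (t : Fin n → ℝ),
    IdentDistrib (fun ω i => X (t i) ω) (fun ω i => Y (t i) ω) P P'

/-- The law of `U` is proper: it is not concentrated on a proper subspace of `ℝᵖ`. -/
def IsProper {p : ℕ} {Ω : Type*} [MeasurableSpace Ω] (U : Ω → EuclideanSpace ℝ (Fin p))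
    (P : Measure Ω) : Prop :=
  ∀ W : Submodule ℝ (EuclideanSpace ℝ (Fin p)), W ≠ ⊤ → ¬ ∀ᵐ ω ∂P, U ω ∈ W

/-- The process `X` on `(Ω, P)` is a moving average operator fractional Lévy motion with Hurst
matrix `H` and parameter `A`, driven by the Poisson random measure `N` on `(Ω₀, P₀)` with intensity
`ds ⊗ μ`: it is proper and has the finite-dimensional distributions of `∫ g_t(s) z Ñ(ds, dz)`. -/
structure IsMaofLm {p : ℕ} {Ω Ω₀ : Type*} [MeasurableSpace Ω] [MeasurableSpace Ω₀]
    (H : Matrix (Fin p) (Fin p) ℝ) (A : Matrix (Fin p) (Fin p) ℂ)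
    (μ : Measure (EuclideanSpace ℝ (Fin p))) (N : Ω₀ → Measure (ℝ × EuclideanSpace ℝ (Fin p)))
    (P₀ : Measure Ω₀) (X : ℝ → Ω → EuclideanSpace ℝ (Fin p)) (P : Measure Ω) : Prop where
  hurst : reEig H ⊆ Set.Ioo 0 1
  levy : IsLevyL2 μ
  poisson : IsPoissonRandomMeasure N ((volume : Measure ℝ).prod μ) P₀
  proper : ∀ t, t ≠ 0 → IsProper (X t) P
  repr : ∃ Y : ℝ → Ω₀ → EuclideanSpace ℝ (Fin p),
    (∀ t, IsPoissonIntegral N μ P₀ (fun w => matVec (maKernel H A t w.1) w.2) (Y t)) ∧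
    FddEq X P Y P₀

/-- The process `X` on `(Ω, P)` is a real harmonizable operator fractional Lévy motion with Hurst
matrix `H` and parameter `A`, driven by the Poisson random measure `N` on `(Ω, P)` with intensity
`dx ⊗ μ`: it is proper and `X(t) = ∫ (g̃_t(x) z + g̃_t(-x) z̄) Ñ(dx, dz)`. -/
structure IsRhofLm {p : ℕ} {Ω : Type*} [MeasurableSpace Ω]
    (H : Matrix (Fin p) (Fin p) ℝ) (A : Matrix (Fin p) (Fin p) ℂ)
    (μ : Measure (EuclideanSpace ℂ (Fin p))) (N : Ω → Measure (ℝ × EuclideanSpace ℂ (Fin p)))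
    (X : ℝ → Ω → EuclideanSpace ℝ (Fin p)) (P : Measure Ω) : Prop where
  hurst : reEig H ⊆ Set.Ioo 0 1
  levy : IsLevyL2 μ
  poisson : IsPoissonRandomMeasure N ((volume : Measure ℝ).prod μ) P
  proper : ∀ t, t ≠ 0 → IsProper (X t) P
  repr : ∀ t, IsPoissonIntegral N μ P
    (fun w => matVec (harmKernel H A t w.1) w.2 + matVec (harmKernel H A t (-w.1)) (conjVec w.2))
    (fun ω => toC (X t ω))

/-- `∫ z z* μ(dz) = I`, for a measure `μ` on `ℝᵖ`. -/
def UnitSecondMoment {p : ℕ} (μ : Measure (EuclideanSpace ℝ (Fin p))) : Prop :=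
  (Matrix.of fun i j => ∫ z, z i * z j ∂μ : Matrix (Fin p) (Fin p) ℝ) = 1

/-- `4 ∫ (Re z) (Re z)* μ(dz) = I = 4 ∫ (Im z) (Im z)* μ(dz)`, for a measure `μ` on `ℂᵖ`. -/
def UnitSecondMomentC {p : ℕ} (μ : Measure (EuclideanSpace ℂ (Fin p))) : Prop :=
  (4 : ℝ) • (Matrix.of fun i j => ∫ z, (z i).re * (z j).re ∂μ : Matrix (Fin p) (Fin p) ℝ) = 1 ∧
  (4 : ℝ) • (Matrix.of fun i j => ∫ z, (z i).im * (z j).im ∂μ : Matrix (Fin p) (Fin p) ℝ) = 1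

/-- Invariance of `μ` under the rotations `z ↦ e^{iθ} z` of `ℂᵖ`. -/
def RotationInvariant {p : ℕ} (μ : Measure (EuclideanSpace ℂ (Fin p))) : Prop :=
  ∀ θ ∈ Set.Ico (-Real.pi) Real.pi, μ.map (fun z => Complex.exp (Complex.I * θ) • z) = μ

end OfLm

end

/-!
Let `K i : L²(ℝ) → L²(P)` be isometries with pairwise orthogonal ranges and mean zero values. Then
`Φ(B) = (K i 1_B)_i` is an orthogonal-increment random measure, and `∫ f dΦ` has the coordinates
`∑ j, K j (f i j)`.

In (i), `K i f` is the compensated Poisson integral of `(U f)(s) zᵢ`, where the unitary Fourier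
transform `U` takes the harmonizable kernel to the moving average kernel; Plancherel and
`∫ z z* μ(dz) = I` give the orthogonality. In (ii) it is that of `(U⁻¹ f)(x) zᵢ + (U⁻¹ f)(-x) z̄ᵢ`;
here the cross terms vanish because the quarter turn `z ↦ iz` changes the sign of `∫ zᵢ zⱼ μ(dz)`.
The kernels are square integrable because the real parts of the eigenvalues of `M` govern the
growth of `exp (s M)`.
-/

noncomputable section

namespace OfLm

section Gram

variable {𝕜 ι V W : Type*} [RCLike 𝕜] [NormedAddCommGroup V] [InnerProductSpace 𝕜 V]
  [NormedAddCommGroup W] [InnerProductSpace 𝕜 W]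

theorem exists_linearIsometry_of_inner_eq [CompleteSpace W] {v : ι → V} {w : ι → W}
    (h : ∀ i j, inner 𝕜 (v i) (v j) = inner 𝕜 (w i) (w j))
    (hv : Dense (Submodule.span 𝕜 (Set.range v) : Set V)) :
    ∃ T : V →ₗᵢ[𝕜] W, ∀ i, T (v i) = w i := by
  set e := Finsupp.linearCombination 𝕜 v
  set f := Finsupp.linearCombination 𝕜 w
  have he : DenseRange e := by
    rwa [DenseRange, ← LinearMap.coe_range, Finsupp.range_linearCombination]
  have hef : ∀ x, ‖f x‖ = ‖e x‖ := fun x => by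
    simp only [@norm_eq_sqrt_re_inner 𝕜, e, f, Finsupp.linearCombination_apply, Finsupp.sum_inner,
      Finsupp.inner_sum, inner_smul_left, inner_smul_right, h]
  have hT : ∀ x, f.extendOfNorm e (e x) = f x := fun x =>
    LinearMap.extendOfNorm_eq he ⟨1, fun x => by rw [one_mul, hef]⟩ x
  have hnorm : ∀ x, ‖f.extendOfNorm e x‖ = ‖x‖ := fun x => he.induction_on x
    (isClosed_eq (by fun_prop) (by fun_prop)) fun x => by rw [hT, hef]
  exact ⟨⟨f.extendOfNorm e, hnorm⟩, fun i => by simpa [e, f] using hT (Finsupp.single i 1)⟩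

end Gram

section Lp

variable {α : Type*} [MeasurableSpace α] {μ : Measure α}

lemma toLp_finsetSum {E ι : Type*} [NormedAddCommGroup E] {q : ℝ≥0∞} (s : Finset ι)
    {f : ι → α → E} (hf : ∀ i, MemLp (f i) q μ) :
    (memLp_finsetSum s fun i _ => hf i).toLp (fun x => ∑ i ∈ s, f i x) =
      ∑ i ∈ s, (hf i).toLp (f i) := by
  classical
  induction s using Finset.induction_on with
  | empty => exact MemLp.toLp_zero _
  | insert a s ha ih =>
    rw [Finset.sum_insert ha, ← ih, ← MemLp.toLp_add]
    exact MemLp.toLp_congr _ _ (ae_of_all _ fun x => by simp [Finset.sum_insert ha])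

lemma compLpL_toLp {E E' : Type*} [NormedAddCommGroup E] [NormedSpace ℝ E]
    [NormedAddCommGroup E'] [NormedSpace ℝ E'] (L : E →L[ℝ] E') {f : α → E}
    (hf : MemLp f 2 μ) : L.compLpL 2 μ (hf.toLp f) = (L.comp_memLp' hf).toLp (L ∘ f) := by
  refine Lp.ext ?_
  filter_upwards [L.coeFn_compLpL (hf.toLp f), hf.coeFn_toLp, (L.comp_memLp' hf).coeFn_toLp]
    with x hx₁ hx₂ hx₃
  rw [hx₁, hx₂, hx₃, Function.comp_apply]

lemma inner_toLp_toLp (𝕜 : Type*) [RCLike 𝕜] {E : Type*} [NormedAddCommGroup E]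
    [InnerProductSpace 𝕜 E] {f g : α → E} (hf : MemLp f 2 μ) (hg : MemLp g 2 μ) :
    inner 𝕜 (hf.toLp f) (hg.toLp g) = ∫ x, inner 𝕜 (f x) (g x) ∂μ := by
  refine integral_congr_ae ?_
  filter_upwards [hf.coeFn_toLp, hg.coeFn_toLp] with x hx₁ hx₂
  rw [hx₁, hx₂]

lemma dense_span_indicatorConstLp (𝕜 : Type*) [RCLike 𝕜] :
    Dense (Submodule.span 𝕜 (Set.range fun B : {B : Set α // MeasurableSet B ∧ μ B ≠ ∞} =>
      indicatorConstLp 2 B.2.1 B.2.2 (1 : 𝕜)) : Set (Lp 𝕜 2 μ)) := by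
  set M := Submodule.span 𝕜 (Set.range fun B : {B : Set α // MeasurableSet B ∧ μ B ≠ ∞} =>
      indicatorConstLp 2 B.2.1 B.2.2 (1 : 𝕜))
  refine fun f => Lp.induction (by norm_num) (fun f => f ∈ M.topologicalClosure)
    (fun c s hs hμs => ?_) (fun f g _ _ _ => M.topologicalClosure.add_mem)
    M.isClosed_topologicalClosure f
  have hc : (Lp.simpleFunc.indicatorConst 2 hs hμs.ne c : Lp 𝕜 2 μ) =
      c • indicatorConstLp 2 hs hμs.ne (1 : 𝕜) := by
    rw [Lp.simpleFunc.coe_indicatorConst, indicatorConstLp, indicatorConstLp,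
      ← MemLp.toLp_const_smul]
    exact MemLp.toLp_congr _ _ (ae_of_all _ fun x => by by_cases hx : x ∈ s <;> simp [hx])
  rw [hc]
  exact M.le_topologicalClosure (M.smul_mem _ (Submodule.subset_span ⟨⟨s, hs, hμs.ne⟩, rfl⟩))

/-- Pointwise complex conjugation on `L²(μ)`. -/
def conjLp (μ : Measure α) : Lp ℂ 2 μ →L⋆[ℂ] Lp ℂ 2 μ :=
  ((starL ℂ : ℂ ≃L⋆[ℂ] ℂ) : ℂ →L⋆[ℂ] ℂ).compLpL 2 μ

lemma coeFn_conjLp (f : Lp ℂ 2 μ) : conjLp μ f =ᵐ[μ] fun x => (starRingEnd ℂ) (f x) :=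
  ContinuousLinearMap.coeFn_compLpL _ f

lemma conjLp_toLp {f : α → ℂ} (hf : MemLp f 2 μ) :
    conjLp μ (hf.toLp f) = hf.star.toLp (star f) := by
  ext1
  filter_upwards [coeFn_conjLp (hf.toLp f), hf.coeFn_toLp, hf.star.coeFn_toLp] with x h₁ h₂ h₃
  simp [h₁, h₂, h₃]

lemma conjLp_conjLp (f : Lp ℂ 2 μ) : conjLp μ (conjLp μ f) = f := by
  ext1
  filter_upwards [coeFn_conjLp (conjLp μ f), coeFn_conjLp f] with x h₁ h₂
  simp [h₁, h₂]

lemma conjLp_indicatorConstLp_one {B : Set α} (hB : MeasurableSet B) (hμB : μ B ≠ ∞) :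
    conjLp μ (indicatorConstLp 2 hB hμB 1) = indicatorConstLp 2 hB hμB 1 := by
  rw [indicatorConstLp, conjLp_toLp]
  exact MemLp.toLp_congr _ _ (ae_of_all _ fun x => by
    by_cases hx : x ∈ B <;> simp [hx])

lemma ofReal_re_ae_eq_of_conjLp_eq {f : Lp ℂ 2 μ} (hf : conjLp μ f = f) :
    ∀ᵐ x ∂μ, (((f x).re : ℝ) : ℂ) = f x := by
  filter_upwards [hf ▸ coeFn_conjLp f] with x hx
  exact Complex.conj_eq_iff_re.1 hx.symm

end Lp

section PoissonMoments

lemma hasSum_poisson_mul_cast (r : ℝ) :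
    HasSum (fun n : ℕ => Real.exp (-r) * r ^ n / n.factorial * n) r := by
  have hshift : ∀ n : ℕ, Real.exp (-r) * r ^ (n + 1) / (n + 1).factorial * ((n + 1 : ℕ) : ℝ) =
      r * (Real.exp (-r) * (r ^ n / n.factorial)) := fun n => by
    rw [Nat.factorial_succ]
    push_cast
    field_simp
    ring
  have hexp := (NormedSpace.expSeries_div_hasSum_exp r).mul_left (Real.exp (-r))
  rw [← Real.exp_eq_exp_ℝ, ← Real.exp_add, neg_add_cancel, Real.exp_zero] at hexp
  rw [← hasSum_nat_add_iff' 1]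
  simpa only [hshift, Finset.sum_range_one, Nat.cast_zero, mul_zero, sub_zero, mul_one]
    using hexp.mul_left r

lemma hasSum_poisson_mul_cast_sq (r : ℝ) :
    HasSum (fun n : ℕ => Real.exp (-r) * r ^ n / n.factorial * (n : ℝ) ^ 2) (r ^ 2 + r) := by
  have hshift : ∀ n : ℕ,
      Real.exp (-r) * r ^ (n + 1) / (n + 1).factorial * ((n + 1 : ℕ) : ℝ) ^ 2 =
        r * (Real.exp (-r) * r ^ n / n.factorial * n) +
          Real.exp (-r) * r ^ (n + 1) / (n + 1).factorial * ((n + 1 : ℕ) : ℝ) := fun n => by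
    rw [Nat.factorial_succ]
    push_cast
    field_simp
    ring
  have hmean := hasSum_poisson_mul_cast r
  have hmul := hmean.mul_left r
  rw [← hasSum_nat_add_iff' 1] at hmean ⊢
  simpa only [hshift, Finset.sum_range_one, Nat.cast_zero, zero_pow two_ne_zero, mul_zero, sub_zero,
    ← sq] using hmul.add hmean

variable (r : NNReal)

lemma memLp_cast_poissonMeasure : MemLp (fun n : ℕ => (n : ℝ)) 2 (poissonMeasure r) := by
  rw [memLp_two_iff_integrable_sq .of_discrete, integrable_poissonMeasure_iff]
  simpa using (hasSum_poisson_mul_cast_sq r).summable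

lemma integral_cast_poissonMeasure : ∫ n : ℕ, (n : ℝ) ∂poissonMeasure r = r := by
  rw [integral_poissonMeasure]
  simpa using (hasSum_poisson_mul_cast r).tsum_eq

lemma variance_cast_poissonMeasure : Var[fun n : ℕ => (n : ℝ); poissonMeasure r] = r := by
  rw [variance_eq_sub (memLp_cast_poissonMeasure r), integral_cast_poissonMeasure,
    integral_poissonMeasure]
  simpa [sub_eq_iff_eq_add'] using (hasSum_poisson_mul_cast_sq r).tsum_eq

end PoissonMoments

section Compensated

lemma covariance_congr_left {Ω : Type*} [MeasurableSpace Ω] {P : Measure Ω} {X X' Y : Ω → ℝ}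
    (hX : X =ᵐ[P] X') : cov[X, Y; P] = cov[X', Y; P] := by
  rw [covariance, covariance, integral_congr_ae hX]
  exact integral_congr_ae (hX.mono fun ω hω => by simp only [hω])

variable {S Ω : Type*} [MeasurableSpace S] [MeasurableSpace Ω]

/-- The compensated random measure `Ñ(B) = N(B) - ν(B)` of a set `B` of finite intensity; an
infinite mass is read as `0`. -/
def compensated (N : Ω → Measure S) (ν : Measure S) (B : Set S) (ω : Ω) : ℝ :=
  (N ω).real B - ν.real B

namespace IsPoissonRandomMeasure

variable {N : Ω → Measure S} {ν : Measure S} {P : Measure Ω} {B C : Set S}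

lemma measurable_real (h : IsPoissonRandomMeasure N ν P) (hB : MeasurableSet B) :
    Measurable fun ω => (N ω).real B :=
  (h.measurable B hB).ennreal_toReal

lemma hasLaw_real (h : IsPoissonRandomMeasure N ν P) (hB : MeasurableSet B) (hνB : ν B ≠ ∞) :
    HasLaw (fun ω => (N ω).real B)
      ((poissonMeasure (ν B).toNNReal).map fun n : ℕ => (n : ℝ)) P where
  aemeasurable := (h.measurable_real hB).aemeasurable
  map_eq := by
    have hcomp := Measure.map_map (μ := P) ENNReal.measurable_toReal (h.measurable B hB)
    rw [h.law B hB hνB, Measure.map_map ENNReal.measurable_toReal .of_discrete] at hcomp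
    simpa [Function.comp_def, Measure.real] using hcomp.symm

lemma ae_lt_top (h : IsPoissonRandomMeasure N ν P) (hB : MeasurableSet B) (hνB : ν B ≠ ∞) :
    ∀ᵐ ω ∂P, N ω B < ∞ := by
  have : ∀ᵐ x ∂(P.map fun ω => N ω B), x < ∞ := by
    rw [h.law B hB hνB, ae_map_iff .of_discrete measurableSet_Iio]
    simp
  exact ae_of_ae_map (h.measurable B hB).aemeasurable this

lemma memLp_real (h : IsPoissonRandomMeasure N ν P) (hB : MeasurableSet B) (hνB : ν B ≠ ∞) :
    MemLp (fun ω => (N ω).real B) 2 P := by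
  have hlaw := h.hasLaw_real hB hνB
  refine MemLp.comp_of_map (f := fun ω => (N ω).real B) (g := id) ?_ hlaw.aemeasurable
  rw [hlaw.map_eq, memLp_map_measure_iff (by fun_prop) .of_discrete]
  exact memLp_cast_poissonMeasure _

lemma indepFun_compensated (h : IsPoissonRandomMeasure N ν P) (hB : MeasurableSet B)
    (hC : MeasurableSet C) (hBC : Disjoint B C) :
    IndepFun (compensated N ν B) (compensated N ν C) P := by
  have hind := h.indep 2 ![B, C] (by simp [Fin.forall_fin_two, hB, hC])
    (by simp [Pairwise, Function.onFun, Fin.forall_fin_two, hBC, hBC.symm])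
  have hN : IndepFun (fun ω => N ω B) (fun ω => N ω C) P := by
    simpa using hind.indepFun (i := 0) (j := 1) (by norm_num)
  exact hN.comp (φ := fun x => x.toReal - ν.real B) (ψ := fun x => x.toReal - ν.real C)
    (by fun_prop) (by fun_prop)

lemma compensated_ae_eq_inter_add_sdiff (h : IsPoissonRandomMeasure N ν P) (hB : MeasurableSet B)
    (hνB : ν B ≠ ∞) (hC : MeasurableSet C) :
    compensated N ν B =ᵐ[P] compensated N ν (B ∩ C) + compensated N ν (B \ C) := by
  filter_upwards [h.ae_lt_top hB hνB] with ω hω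
  simp only [compensated, Pi.add_apply, ← measureReal_inter_add_sdiff hC hω.ne,
    ← measureReal_inter_add_sdiff hC hνB]
  ring

variable [IsProbabilityMeasure P]

lemma memLp_compensated (h : IsPoissonRandomMeasure N ν P) (hB : MeasurableSet B)
    (hνB : ν B ≠ ∞) : MemLp (compensated N ν B) 2 P :=
  (h.memLp_real hB hνB).sub (memLp_const _)

lemma integral_compensated (h : IsPoissonRandomMeasure N ν P) (hB : MeasurableSet B)
    (hνB : ν B ≠ ∞) : ∫ ω, compensated N ν B ω ∂P = 0 := by
  have hmean : ∫ ω, (N ω).real B ∂P = ν.real B := by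
    rw [(h.hasLaw_real hB hνB).integral_eq, integral_map .of_discrete (by fun_prop),
      integral_cast_poissonMeasure]
    rfl
  simp only [compensated]
  rw [integral_sub ((h.memLp_real hB hνB).integrable (by norm_num)) (integrable_const _), hmean]
  simp

lemma variance_compensated (h : IsPoissonRandomMeasure N ν P) (hB : MeasurableSet B)
    (hνB : ν B ≠ ∞) : Var[compensated N ν B; P] = ν.real B := by
  unfold compensated
  rw [variance_sub_const (h.measurable_real hB).aestronglyMeasurable,
    (h.hasLaw_real hB hνB).variance_eq, variance_map (by fun_prop) .of_discrete]
  exact variance_cast_poissonMeasure _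

lemma covariance_compensated_eq_inter_left (h : IsPoissonRandomMeasure N ν P)
    (hB : MeasurableSet B) (hνB : ν B ≠ ∞) (hC : MeasurableSet C) (hνC : ν C ≠ ∞) :
    cov[compensated N ν B, compensated N ν C; P] =
      cov[compensated N ν (B ∩ C), compensated N ν C; P] := by
  have hinter := h.memLp_compensated (hB.inter hC)
    (measure_ne_top_of_subset Set.inter_subset_left hνB)
  have hdiff := h.memLp_compensated (hB.diff hC) (measure_ne_top_of_subset Set.sdiff_subset hνB)
  have hC' := h.memLp_compensated hC hνC
  rw [covariance_congr_left (h.compensated_ae_eq_inter_add_sdiff hB hνB hC),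
    covariance_add_left hinter hdiff hC',
    (h.indepFun_compensated (hB.diff hC) hC Set.disjoint_sdiff_left).covariance_eq_zero hdiff hC',
    add_zero]

theorem covariance_compensated (h : IsPoissonRandomMeasure N ν P) (hB : MeasurableSet B)
    (hνB : ν B ≠ ∞) (hC : MeasurableSet C) (hνC : ν C ≠ ∞) :
    cov[compensated N ν B, compensated N ν C; P] = ν.real (B ∩ C) := by
  have hBC : MeasurableSet (B ∩ C) := hB.inter hC
  have hνBC : ν (B ∩ C) ≠ ∞ := measure_ne_top_of_subset Set.inter_subset_left hνB
  rw [h.covariance_compensated_eq_inter_left hB hνB hC hνC, covariance_comm,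
    h.covariance_compensated_eq_inter_left hC hνC hBC hνBC,
    Set.inter_eq_right.2 Set.inter_subset_right,
    covariance_self (h.memLp_compensated hBC hνBC).aemeasurable, h.variance_compensated hBC hνBC]

end IsPoissonRandomMeasure

end Compensated

section PoissonIntegral

variable {S Ω : Type*} [MeasurableSpace S] [MeasurableSpace Ω] {N : Ω → Measure S}
  {ν : Measure S} {P : Measure Ω} [IsProbabilityMeasure P]

namespace IsPoissonRandomMeasure

/-- The compensated mass `Ñ(B)` as an element of `L²(P; ℂ)`. -/
def compensatedLp (h : IsPoissonRandomMeasure N ν P) {B : Set S} (hB : MeasurableSet B)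
    (hνB : ν B ≠ ∞) : Lp ℂ 2 P :=
  (h.memLp_compensated hB hνB).ofReal.toLp _

variable (h : IsPoissonRandomMeasure N ν P) {B C : Set S}

lemma coeFn_compensatedLp (hB : MeasurableSet B) (hνB : ν B ≠ ∞) :
    h.compensatedLp hB hνB =ᵐ[P] fun ω => (compensated N ν B ω : ℂ) :=
  MemLp.coeFn_toLp _

lemma conjLp_compensatedLp (hB : MeasurableSet B) (hνB : ν B ≠ ∞) :
    conjLp P (h.compensatedLp hB hνB) = h.compensatedLp hB hνB := by
  rw [compensatedLp, conjLp_toLp]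
  exact MemLp.toLp_congr _ _ (ae_of_all _ fun ω => Complex.conj_ofReal _)

lemma inner_compensatedLp (hB : MeasurableSet B) (hνB : ν B ≠ ∞) (hC : MeasurableSet C)
    (hνC : ν C ≠ ∞) :
    inner ℂ (h.compensatedLp hB hνB) (h.compensatedLp hC hνC) = ν.real (B ∩ C) := by
  have hcov := covariance_eq_sub (h.memLp_compensated hB hνB) (h.memLp_compensated hC hνC)
  rw [h.covariance_compensated hB hνB hC hνC, h.integral_compensated hB hνB, zero_mul,
    sub_zero] at hcov
  rw [compensatedLp, compensatedLp, inner_toLp_toLp, hcov, ← integral_complex_ofReal]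
  exact integral_congr_ae (ae_of_all _ fun ω => by simp [mul_comm])

lemma exists_integral : ∃ I : Lp ℂ 2 ν →ₗᵢ[ℂ] Lp ℂ 2 P,
    ∀ B : {B : Set S // MeasurableSet B ∧ ν B ≠ ∞},
      I (indicatorConstLp 2 B.2.1 B.2.2 1) = h.compensatedLp B.2.1 B.2.2 :=
  exists_linearIsometry_of_inner_eq
    (fun B C => (L2.inner_indicatorConstLp_one_indicatorConstLp_one B.2.1 C.2.1 B.2.2 C.2.2).trans
      (h.inner_compensatedLp B.2.1 B.2.2 C.2.1 C.2.2).symm)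
    (dense_span_indicatorConstLp ℂ)

/-- The stochastic integral `f ↦ ∫ f dÑ` as the isometry from `L²(ν)` to `L²(P)` which sends the
indicator of `B` to `Ñ(B)`. -/
def integral : Lp ℂ 2 ν →ₗᵢ[ℂ] Lp ℂ 2 P := h.exists_integral.choose

lemma integral_indicatorConstLp (hB : MeasurableSet B) (hνB : ν B ≠ ∞) :
    h.integral (indicatorConstLp 2 hB hνB 1) = h.compensatedLp hB hνB :=
  h.exists_integral.choose_spec ⟨B, hB, hνB⟩

lemma conjLp_integral (f : Lp ℂ 2 ν) : conjLp P (h.integral f) = h.integral (conjLp ν f) := by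
  have hext : (conjLp P).comp h.integral.toContinuousLinearMap =
      h.integral.toContinuousLinearMap.comp (conjLp ν) := by
    refine ContinuousLinearMap.ext_on (dense_span_indicatorConstLp ℂ) ?_
    rintro _ ⟨⟨B, hB, hνB⟩, rfl⟩
    simp [h.integral_indicatorConstLp hB hνB, conjLp_compensatedLp, conjLp_indicatorConstLp_one]
  exact DFunLike.congr_fun hext f

lemma integral_integral_eq_zero (f : Lp ℂ 2 ν) : ∫ ω, h.integral f ω ∂P = 0 := by
  set mean : Lp ℂ 2 P →L[ℂ] ℂ :=
    innerSL ℂ (indicatorConstLp 2 MeasurableSet.univ (measure_ne_top P _) (1 : ℂ))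
  have hmean : ∀ g : Lp ℂ 2 P, mean g = ∫ ω, g ω ∂P := fun g => by
    rw [innerSL_apply_apply, L2.inner_indicatorConstLp_one, setIntegral_univ]
  have hext : mean.comp h.integral.toContinuousLinearMap = 0 := by
    refine ContinuousLinearMap.ext_on (dense_span_indicatorConstLp ℂ) ?_
    rintro _ ⟨⟨B, hB, hνB⟩, rfl⟩
    simp [h.integral_indicatorConstLp hB hνB, hmean,
      integral_congr_ae (h.coeFn_compensatedLp hB hνB), integral_complex_ofReal,
      h.integral_compensated hB hνB]
  rw [← hmean]
  exact DFunLike.congr_fun hext f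

end IsPoissonRandomMeasure

end PoissonIntegral

section StepFn

variable {S : Type*} [MeasurableSpace S] {ν : Measure S} {W V : Type*}

namespace StepFn

lemma map_eval [AddCommMonoid W] [AddCommMonoid V] (F : StepFn S ν W) (L : W →+ V) (x : S) :
    L (F.eval x) = ∑ j, (F.set j).indicator (fun _ => L (F.coef j)) x := by
  rw [eval, map_sum]
  exact Finset.sum_congr rfl fun j _ => (congrFun (Set.indicator_comp_of_zero (map_zero L)) x).symm

lemma memLp_map_eval [AddCommMonoid W] [NormedAddCommGroup V] (F : StepFn S ν W) (L : W →+ V) :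
    MemLp (fun x => L (F.eval x)) 2 ν := by
  simp only [map_eval]
  exact memLp_finsetSum _ fun j _ =>
    memLp_indicator_const 2 (F.measurableSet j) _ (.inr (F.finite j))

lemma toLp_map_eval {𝕜 : Type*} [RCLike 𝕜] [AddCommMonoid W] (F : StepFn S ν W) (L : W →+ 𝕜) :
    (F.memLp_map_eval L).toLp _ =
      ∑ j, L (F.coef j) • indicatorConstLp 2 (F.measurableSet j) (F.finite j) 1 := by
  have hterm : ∀ j, MemLp ((F.set j).indicator fun _ => L (F.coef j)) 2 ν := fun j =>
    memLp_indicator_const 2 (F.measurableSet j) _ (.inr (F.finite j))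
  calc (F.memLp_map_eval L).toLp _
      = (memLp_finsetSum Finset.univ fun j _ => hterm j).toLp _ :=
        MemLp.toLp_congr _ _ (ae_of_all _ (F.map_eval L))
    _ = ∑ j, (hterm j).toLp _ := toLp_finsetSum _ hterm
    _ = _ := Finset.sum_congr rfl fun j _ => by
        rw [indicatorConstLp, ← MemLp.toLp_const_smul]
        exact MemLp.toLp_congr _ _ (ae_of_all _ fun x => by
          by_cases hx : x ∈ F.set j <;> simp [hx])

end StepFn

lemma exists_stepFn_eval_eq [NormedAddCommGroup W] (g : SimpleFunc S W) (hg : MemLp g 2 ν) :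
    ∃ F : StepFn S ν W, F.eval = g := by
  classical
  set T := g.range.filter (· ≠ 0)
  refine ⟨{ n := T.card
            coef := fun k => T.equivFin.symm k
            set := fun k => g ⁻¹' {(T.equivFin.symm k : W)}
            measurableSet := fun k => g.measurableSet_fiber _
            finite := fun k => (g.measure_preimage_lt_top_of_memLp two_ne_zero ENNReal.ofNat_ne_top
              hg _ (Finset.mem_filter.1 (T.equivFin.symm k).2).2).ne }, funext fun x => ?_⟩
  calc ∑ k, (g ⁻¹' {(T.equivFin.symm k : W)}).indicator (fun _ => (T.equivFin.symm k : W)) x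
      = ∑ c : T, (g ⁻¹' {(c : W)}).indicator (fun _ => (c : W)) x :=
        T.equivFin.symm.sum_comp fun c : T => (g ⁻¹' {(c : W)}).indicator (fun _ => (c : W)) x
    _ = ∑ c ∈ T, (g ⁻¹' {c}).indicator (fun _ => c) x :=
        Finset.sum_coe_sort T fun c => (g ⁻¹' {c}).indicator (fun _ => c) x
    _ = g x := by
        simp only [Set.indicator_apply, Set.mem_preimage, Set.mem_singleton_iff,
          Finset.sum_ite_eq, T, Finset.mem_filter, g.mem_range_self, true_and, ite_not]
        split_ifs with hx
        exacts [hx.symm, rfl]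

lemma exists_stepFn_tendsto [NormedAddCommGroup W] {f : S → W} (hf : MemLp f 2 ν) :
    ∃ F : ℕ → StepFn S ν W, Tendsto (fun k => eLpNorm ((F k).eval - f) 2 ν) atTop (𝓝 0) := by
  have happrox : ∀ k : ℕ, ∃ F : StepFn S ν W, eLpNorm (F.eval - f) 2 ν < (k : ℝ≥0∞)⁻¹ :=
    fun k => by
      obtain ⟨g, hgf, hg⟩ := hf.exists_simpleFunc_eLpNorm_sub_lt ENNReal.ofNat_ne_top
        (ENNReal.inv_ne_zero.2 (ENNReal.natCast_ne_top k))
      obtain ⟨F, hF⟩ := exists_stepFn_eval_eq g hg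
      exact ⟨F, by rwa [hF, eLpNorm_sub_comm]⟩
  choose F hF using happrox
  exact ⟨F, tendsto_of_tendsto_of_tendsto_of_le_of_le tendsto_const_nhds
    ENNReal.tendsto_inv_nat_nhds_zero (fun _ => zero_le) fun k => (hF k).le⟩

end StepFn

section VectorL2

variable {Ω : Type*} [MeasurableSpace Ω] {P : Measure Ω} {𝕜 ι : Type*} [RCLike 𝕜] [Fintype ι]

lemma norm_le_sum_norm_apply (v : EuclideanSpace 𝕜 ι) : ‖v‖ ≤ ∑ i, ‖v i‖ := by
  conv_lhs => rw [← (EuclideanSpace.basisFun ι 𝕜).sum_repr v]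
  refine (norm_sum_le _ _).trans (Finset.sum_le_sum fun i _ => ?_)
  simp [norm_smul]

lemma eLpNorm_le_sum_eLpNorm_apply {U : Ω → EuclideanSpace 𝕜 ι} (hU : AEStronglyMeasurable U P) :
    eLpNorm U 2 P ≤ ∑ i, eLpNorm (fun ω => U ω i) 2 P :=
  calc eLpNorm U 2 P ≤ eLpNorm (∑ i, fun ω => ‖U ω i‖) 2 P := eLpNorm_mono_real fun ω => by
        simpa only [Finset.sum_apply] using norm_le_sum_norm_apply (U ω)
    _ ≤ ∑ i, eLpNorm (fun ω => ‖U ω i‖) 2 P := eLpNorm_sum_le (fun i _ =>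
        ((EuclideanSpace.proj (𝕜 := 𝕜) i).continuous.comp_aestronglyMeasurable hU).norm)
        one_le_two
    _ = ∑ i, eLpNorm (fun ω => U ω i) 2 P := by simp only [eLpNorm_norm]

lemma memLp_of_ae_eq_apply {U : Ω → EuclideanSpace 𝕜 ι} {u : ι → Lp 𝕜 2 P}
    (hU : ∀ i, (fun ω => U ω i) =ᵐ[P] u i) : MemLp U 2 P :=
  MemLp.of_eval_piLp fun i => (Lp.memLp (u i)).ae_eq (hU i).symm

lemma tendsto_eLpNorm_sub_of_tendsto_apply {U : ℕ → Ω → EuclideanSpace 𝕜 ι}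
    {V : Ω → EuclideanSpace 𝕜 ι} {u : ℕ → ι → Lp 𝕜 2 P} {v : ι → Lp 𝕜 2 P}
    (hU : ∀ n i, (fun ω => U n ω i) =ᵐ[P] u n i) (hV : ∀ i, (fun ω => V ω i) =ᵐ[P] v i)
    (huv : ∀ i, Tendsto (fun n => u n i) atTop (𝓝 (v i))) :
    Tendsto (fun n => eLpNorm (fun ω => U n ω - V ω) 2 P) atTop (𝓝 0) := by
  have hcoord : ∀ i, Tendsto (fun n => eLpNorm (fun ω => (U n ω - V ω) i) 2 P) atTop (𝓝 0) :=
    fun i => ((Lp.tendsto_Lp_iff_tendsto_eLpNorm' _ _).1 (huv i)).congr fun n =>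
      eLpNorm_congr_ae ((hU n i).sub (hV i)).symm
  refine tendsto_of_tendsto_of_tendsto_of_le_of_le tendsto_const_nhds
    (by simpa using tendsto_finsetSum Finset.univ fun i _ => hcoord i) (fun _ => zero_le)
    fun n => eLpNorm_le_sum_eLpNorm_apply ?_
  exact ((memLp_of_ae_eq_apply (hU n)).sub (memLp_of_ae_eq_apply hV)).aestronglyMeasurable

lemma crossMoment_apply {p : ℕ} {U V : Ω → EuclideanSpace 𝕜 (Fin p)} {i j : Fin p}
    {f g : Lp 𝕜 2 P} (hU : (fun ω => U ω i) =ᵐ[P] f) (hV : (fun ω => V ω j) =ᵐ[P] g) :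
    crossMoment P U V i j = inner 𝕜 g f := by
  rw [crossMoment, Matrix.of_apply, L2.inner_def]
  refine integral_congr_ae ?_
  filter_upwards [hU, hV] with ω hω₁ hω₂
  rw [hω₁, hω₂, RCLike.inner_apply, mul_comm]

end VectorL2

section PoissonIntegralVector

variable {Ω : Type*} [MeasurableSpace Ω] {P : Measure Ω} {𝕜 : Type*} [RCLike 𝕜] {p : ℕ}

section

variable {S : Type*} [MeasurableSpace S] {ν : Measure S} [IsProbabilityMeasure P]
  {N : Ω → Measure S}

lemma StepFn.memLp_poissonInt (h : IsPoissonRandomMeasure N ν P)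
    (F : StepFn S ν (EuclideanSpace 𝕜 (Fin p))) : MemLp (F.poissonInt N) 2 P :=
  memLp_finsetSum _ fun j _ => (ContinuousLinearMap.toSpanSingleton 𝕜 (F.coef j)).comp_memLp'
    (h.memLp_compensated (F.measurableSet j) (F.finite j)).ofReal

lemma StepFn.toLp_comp_poissonInt (h : IsPoissonRandomMeasure N ν P)
    (F : StepFn S ν (EuclideanSpace 𝕜 (Fin p))) (L : EuclideanSpace 𝕜 (Fin p) →L[ℝ] ℂ) :
    (L.comp_memLp' (F.memLp_poissonInt h)).toLp (L ∘ F.poissonInt N) =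
      ∑ j, L (F.coef j) • h.compensatedLp (F.measurableSet j) (F.finite j) := by
  have hterm := fun j => (h.memLp_compensated (F.measurableSet j) (F.finite j)).ofReal (K := ℂ)
    |>.const_smul (L (F.coef j))
  calc (L.comp_memLp' (F.memLp_poissonInt h)).toLp (L ∘ F.poissonInt N)
      = (memLp_finsetSum Finset.univ fun j _ => hterm j).toLp _ :=
        MemLp.toLp_congr _ _ (ae_of_all _ fun ω => by
          simp only [poissonInt, compensated, Measure.real, Function.comp_apply, map_sum,
            ← RCLike.real_smul_eq_coe_smul, map_smul, Pi.smul_apply, smul_eq_mul,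
            Complex.real_smul, mul_comm]
          rfl)
    _ = ∑ j, (hterm j).toLp _ := toLp_finsetSum _ hterm
    _ = _ := rfl

lemma StepFn.integral_toLp_eval (h : IsPoissonRandomMeasure N ν P)
    (F : StepFn S ν (EuclideanSpace 𝕜 (Fin p))) (L : EuclideanSpace 𝕜 (Fin p) →L[ℝ] ℂ) :
    h.integral ((F.memLp_map_eval (L : EuclideanSpace 𝕜 (Fin p) →+ ℂ)).toLp _) =
      (L.comp_memLp' (F.memLp_poissonInt h)).toLp (L ∘ F.poissonInt N) := by
  rw [toLp_map_eval, toLp_comp_poissonInt h, map_sum]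
  simp only [map_smul, h.integral_indicatorConstLp, AddMonoidHom.coe_coe]

end

lemma IsPoissonIntegral.integral_toLp [IsProbabilityMeasure P]
    {N : Ω → Measure (ℝ × EuclideanSpace 𝕜 (Fin p))} {μ : Measure (EuclideanSpace 𝕜 (Fin p))}
    (h : IsPoissonRandomMeasure N ((volume : Measure ℝ).prod μ) P)
    {φ : ℝ × EuclideanSpace 𝕜 (Fin p) → EuclideanSpace 𝕜 (Fin p)}
    {Y : Ω → EuclideanSpace 𝕜 (Fin p)} (hY : IsPoissonIntegral N μ P φ Y)
    (L : EuclideanSpace 𝕜 (Fin p) →L[ℝ] ℂ) :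
    h.integral ((L.comp_memLp' hY.1).toLp (L ∘ φ)) = (L.comp_memLp' hY.2.1).toLp (L ∘ Y) := by
  obtain ⟨hφ, hYm, F, -, hFφ, hFY⟩ := hY
  have hF : ∀ k, MemLp (F k).eval 2 ((volume : Measure ℝ).prod μ) := fun k =>
    (F k).memLp_map_eval (AddMonoidHom.id _)
  have htendsφ := (h.integral.continuous.comp (L.compLpL 2 _).continuous).continuousAt.tendsto.comp
    ((Lp.tendsto_Lp_iff_tendsto_eLpNorm'' _ hF _ hφ).2 hFφ)
  have htendsY := (L.compLpL 2 P).continuous.continuousAt.tendsto.comp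
    ((Lp.tendsto_Lp_iff_tendsto_eLpNorm'' _ (fun k => (F k).memLp_poissonInt h) _ hYm).2 hFY)
  simp only [Function.comp_def, compLpL_toLp] at htendsφ htendsY
  exact tendsto_nhds_unique htendsφ (htendsY.congr fun k => ((F k).integral_toLp_eval h L).symm)

end PoissonIntegralVector

lemma tendsto_sum_indicatorConstLp {α E : Type*} [MeasurableSpace α] {μ : Measure α}
    [NormedAddCommGroup E] (c : E) {B : ℕ → Set α} (hB : ∀ n, MeasurableSet (B n))
    (hdisj : Pairwise (Function.onFun Disjoint B)) (hμB : ∀ n, μ (B n) ≠ ∞)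
    (hμU : μ (⋃ n, B n) ≠ ∞) :
    Tendsto (fun n => ∑ k ∈ Finset.range n, indicatorConstLp 2 (hB k) (hμB k) c) atTop
      (𝓝 (indicatorConstLp 2 (MeasurableSet.iUnion hB) hμU c)) := by
  set U : ℕ → Set α := fun n => ⋃ k ∈ Finset.range n, B k
  have hU : ∀ n, MeasurableSet (U n) := fun n => Finset.measurableSet_biUnion _ fun k _ => hB k
  have hUsub : ∀ n, U n ⊆ ⋃ n, B n := fun n => Set.iUnion₂_subset fun k _ => Set.subset_iUnion B k
  have hsum : ∀ n, ∑ k ∈ Finset.range n, indicatorConstLp 2 (hB k) (hμB k) c =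
      indicatorConstLp 2 (hU n) (measure_ne_top_of_subset (hUsub n) hμU) c := fun n => by
    refine (toLp_finsetSum _ fun k => memLp_indicator_const 2 (hB k) c (.inr (hμB k))).symm.trans
      (MemLp.toLp_congr _ _ (ae_of_all _ fun x => ?_))
    exact (Finset.indicator_biUnion_apply _ B (fun i _ j _ hij => hdisj hij) x).symm
  have hdiff : ∀ n, symmDiff (U n) (⋃ n, B n) = (⋃ n, B n) \ U n := fun n => by
    rw [Set.symmDiff_def, Set.sdiff_eq_empty.2 (hUsub n), Set.empty_union]
  have hanti : Antitone fun n => (⋃ n, B n) \ U n := fun m n hmn =>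
    Set.sdiff_subset_sdiff_right (Set.biUnion_subset_biUnion_left fun k hk =>
      Finset.mem_range.2 ((Finset.mem_range.1 hk).trans_le hmn))
  have hinter : ⋂ n, (⋃ n, B n) \ U n = ∅ := by
    refine Set.eq_empty_of_forall_notMem fun x hx => ?_
    obtain ⟨k, hk⟩ := Set.mem_iUnion.1 (Set.mem_iInter.1 hx 0).1
    exact (Set.mem_iInter.1 hx (k + 1)).2 (Set.mem_biUnion (Finset.self_mem_range_succ k) hk)
  have hmeas := tendsto_measure_iInter_atTop (μ := μ)
    (fun n => ((MeasurableSet.iUnion hB).diff (hU n)).nullMeasurableSet) hanti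
    ⟨0, measure_ne_top_of_subset Set.sdiff_subset hμU⟩
  simp only [hsum]
  refine tendsto_indicatorConstLp_set ENNReal.ofNat_ne_top ?_
  simpa only [hdiff, hinter, measure_empty, Function.comp_def] using hmeas

section OrthogonalMeasure

variable {Ω : Type*} [MeasurableSpace Ω] {P : Measure Ω} {𝕜 : Type*} [RCLike 𝕜] {p : ℕ}

/-- The operators `K i : L²(ℝ) → L²(P)` are isometries with pairwise orthogonal ranges. -/
def IsOrthogonalIsometryFamily
    (K : Fin p → (Lp 𝕜 2 (volume : Measure ℝ) →L[𝕜] Lp 𝕜 2 P)) : Prop :=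
  ∀ i j f g, inner 𝕜 (K i f) (K j g) = if i = j then inner 𝕜 f g else 0

open Classical in
/-- The random measure `B ↦ (K i 1_B)_i` induced by operators `K i : L²(ℝ) → L²(P)`, with the value
`0` at the sets `B` that are not measurable or have infinite measure. -/
def orthMeasure (K : Fin p → (Lp 𝕜 2 (volume : Measure ℝ) →L[𝕜] Lp 𝕜 2 P)) (B : Set ℝ) (ω : Ω) :
    EuclideanSpace 𝕜 (Fin p) :=
  if h : MeasurableSet B ∧ volume B ≠ ∞ then
    WithLp.toLp 2 fun i => K i (indicatorConstLp 2 h.1 h.2 1) ω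
  else 0

variable {K : Fin p → (Lp 𝕜 2 (volume : Measure ℝ) →L[𝕜] Lp 𝕜 2 P)} {B C : Set ℝ}

lemma orthMeasure_apply (hB : MeasurableSet B) (hvB : volume B ≠ ∞) (i : Fin p) :
    (fun ω => orthMeasure K B ω i) = K i (indicatorConstLp 2 hB hvB 1) := by
  funext ω
  simp [orthMeasure, hB, hvB]

lemma memLp_orthMeasure (hB : MeasurableSet B) (hvB : volume B ≠ ∞) :
    MemLp (orthMeasure K B) 2 P :=
  memLp_of_ae_eq_apply fun i => .of_eq (orthMeasure_apply hB hvB i)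

lemma sum_orthMeasure_apply {ι : Type*} (s : Finset ι) {B : ι → Set ℝ}
    (hB : ∀ k, MeasurableSet (B k)) (hvB : ∀ k, volume (B k) ≠ ∞) (i : Fin p) :
    (fun ω => (∑ k ∈ s, orthMeasure K (B k) ω) i) =ᵐ[P]
      K i (∑ k ∈ s, indicatorConstLp 2 (hB k) (hvB k) 1) := by
  rw [map_sum]
  filter_upwards [Lp.coeFn_finsetSum s fun k => K i (indicatorConstLp 2 (hB k) (hvB k) 1)]
    with ω hω
  rw [hω, WithLp.ofLp_sum, Finset.sum_apply, Finset.sum_apply]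
  simp only [← orthMeasure_apply]

lemma crossMoment_orthMeasure (hK : IsOrthogonalIsometryFamily K) (hB : MeasurableSet B)
    (hvB : volume B ≠ ∞) (hC : MeasurableSet C) (hvC : volume C ≠ ∞) :
    crossMoment P (orthMeasure K B) (orthMeasure K C) =
      (((volume : Measure ℝ).real (C ∩ B) : ℝ) : 𝕜) • 1 := by
  ext i j
  rw [crossMoment_apply (.of_eq (orthMeasure_apply hB hvB i))
    (.of_eq (orthMeasure_apply hC hvC j)), hK,
    L2.inner_indicatorConstLp_one_indicatorConstLp_one hC hB hvC hvB]
  by_cases hij : i = j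
  · simp [hij]
  · simp [hij, Ne.symm hij]

theorem isOrthogonalRandomMeasure_orthMeasure [IsFiniteMeasure P]
    (hK : IsOrthogonalIsometryFamily K) (hmean : ∀ i f, ∫ ω, K i f ω ∂P = 0) :
    IsOrthogonalRandomMeasure (orthMeasure K) P where
  memLp B hB hvB := memLp_orthMeasure hB hvB
  additive B hB hdisj hvU := by
    have hvB : ∀ n, volume (B n) ≠ ∞ := fun n =>
      measure_ne_top_of_subset (Set.subset_iUnion B n) hvU
    exact tendsto_eLpNorm_sub_of_tendsto_apply
      (fun n i => sum_orthMeasure_apply (Finset.range n) hB hvB i)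
      (fun i => .of_eq (orthMeasure_apply (MeasurableSet.iUnion hB) hvU i))
      fun i => ((K i).continuous.tendsto _).comp (tendsto_sum_indicatorConstLp 1 hB hdisj hvB hvU)
  mean_zero B hB hvB := by
    ext i
    have hint : Integrable (orthMeasure K B) P := (memLp_orthMeasure hB hvB).integrable one_le_two
    rw [eval_integral_piLp fun i => hint.eval_piLp i, orthMeasure_apply hB hvB]
    exact hmean i _
  orthogonal B C hB hC hvB hvC hBC := by
    rw [crossMoment_orthMeasure hK hB hvB hC hvC, Set.disjoint_iff_inter_eq_empty.1 hBC.symm]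
    simp
  control B hB hvB := by
    rw [crossMoment_orthMeasure hK hB hvB hB hvB, Set.inter_self, Measure.real]

namespace StepFn

variable (F : StepFn ℝ volume (Matrix (Fin p) (Fin p) 𝕜))

lemma orthInt_apply (i : Fin p) :
    (fun ω => F.orthInt (orthMeasure K) ω i) =ᵐ[P]
      (∑ j, K j ((F.memLp_map_eval (Matrix.entryAddMonoidHom 𝕜 i j)).toLp _) : Lp 𝕜 2 P) := by
  set f := fun k => indicatorConstLp 2 (F.measurableSet k) (F.finite k) (1 : 𝕜)
  have hK : ∑ j, K j ((F.memLp_map_eval (Matrix.entryAddMonoidHom 𝕜 i j)).toLp _) =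
      ∑ j, ∑ k, F.coef k i j • K j (f k) :=
    Finset.sum_congr rfl fun j _ => by rw [toLp_map_eval, map_sum]; simp only [map_smul]; rfl
  rw [hK, Finset.sum_comm]
  have hsum := Lp.coeFn_finsetSum Finset.univ fun k => ∑ j, F.coef k i j • K j (f k)
  have hsum' := fun k => Lp.coeFn_finsetSum Finset.univ fun j => F.coef k i j • K j (f k)
  have hsmul := fun k j => Lp.coeFn_smul (F.coef k i j) (K j (f k))
  filter_upwards [hsum, ae_all_iff.2 hsum', ae_all_iff.2 fun k => ae_all_iff.2 (hsmul k)]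
    with ω hω₁ hω₂ hω₃
  simp only [hω₁, orthInt, WithLp.ofLp_sum, Finset.sum_apply, hω₂, hω₃, Pi.smul_apply, smul_eq_mul,
    matVec, Matrix.mulVec, dotProduct, f, ← orthMeasure_apply]

end StepFn

lemma exists_stepFn_matrix_tendsto {f : ℝ → Matrix (Fin p) (Fin p) 𝕜}
    (hf : ∀ i j, MemLp (fun x => f x i j) 2 (volume : Measure ℝ)) :
    ∃ F : ℕ → StepFn ℝ volume (Matrix (Fin p) (Fin p) 𝕜), ∀ i j,
      Tendsto (fun k => eLpNorm (fun x => (F k).eval x i j - f x i j) 2 (volume : Measure ℝ))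
        atTop (𝓝 0) := by
  obtain ⟨F, hF⟩ := exists_stepFn_tendsto (W := Fin p → Fin p → 𝕜) (f := f)
    (MemLp.of_eval fun i => MemLp.of_eval fun j => hf i j)
  refine ⟨F, fun i j => tendsto_of_tendsto_of_tendsto_of_le_of_le tendsto_const_nhds hF
    (fun _ => zero_le) fun k => eLpNorm_mono fun x => ?_⟩
  exact (norm_le_pi_norm (fun j => (F k).eval x i j - f x i j) j).trans
    (norm_le_pi_norm (fun i j => (F k).eval x i j - f x i j) i)

theorem isOrthIntegral_orthMeasure {f : ℝ → Matrix (Fin p) (Fin p) 𝕜}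
    (hf : ∀ i j, MemLp (fun x => f x i j) 2 (volume : Measure ℝ))
    {Y : Ω → EuclideanSpace 𝕜 (Fin p)}
    (hY : ∀ i, (fun ω => Y ω i) =ᵐ[P] (∑ j, K j ((hf i j).toLp _) : Lp 𝕜 2 P)) :
    IsOrthIntegral (orthMeasure K) P f Y := by
  obtain ⟨F, hF⟩ := exists_stepFn_matrix_tendsto hf
  refine ⟨hf, memLp_of_ae_eq_apply hY, F, hF,
    tendsto_eLpNorm_sub_of_tendsto_apply (fun k i => (F k).orthInt_apply i) hY fun i => ?_⟩
  refine tendsto_finsetSum _ fun j _ => ((K j).continuous.tendsto _).comp ?_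
  rw [Lp.tendsto_Lp_iff_tendsto_eLpNorm'']
  exact hF i j

end OrthogonalMeasure

section Fourier

variable {V : Type*} [NormedAddCommGroup V] [InnerProductSpace ℝ V] [FiniteDimensional ℝ V]
  [MeasurableSpace V] [BorelSpace V]

/-- The reflection `f ↦ f(-·)` on `L²(V)`. -/
def reflectLp : Lp ℂ 2 (volume : Measure V) →ₗᵢ[ℂ] Lp ℂ 2 (volume : Measure V) :=
  Lp.compMeasurePreservingₗᵢ ℂ Neg.neg (Measure.measurePreserving_neg volume)

lemma reflectLp_toLp {f : V → ℂ} (hf : MemLp f 2 (volume : Measure V)) :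
    reflectLp (hf.toLp f) =
      (hf.comp_measurePreserving (Measure.measurePreserving_neg (volume : Measure V))).toLp
        (f ∘ Neg.neg) :=
  Lp.toLp_compMeasurePreserving hf (Measure.measurePreserving_neg volume)

lemma ext_on_schwartz {T U : Lp ℂ 2 (volume : Measure V) → Lp ℂ 2 (volume : Measure V)}
    (hT : Continuous T) (hU : Continuous U)
    (h : ∀ f : SchwartzMap V ℂ, T (f.toLp 2) = U (f.toLp 2)) : T = U :=
  (SchwartzMap.denseRange_toLpCLM (E := V) (F := ℂ) (p := 2) (μ := volume)
    ENNReal.ofNat_ne_top).equalizer hT hU (funext h)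

lemma reflectLp_fourierInv (f : Lp ℂ 2 (volume : Measure V)) : reflectLp (𝓕⁻ f) = 𝓕 f := by
  refine congrFun (ext_on_schwartz
    (reflectLp.continuous.comp ContinuousFourierInv.continuous_fourierInv)
    ContinuousFourier.continuous_fourier fun f => ?_) f
  rw [Function.comp_apply, SchwartzMap.toLp_fourier_eq, SchwartzMap.toLp_fourierInv_eq]
  refine (reflectLp_toLp _).trans (MemLp.toLp_congr _ _ (ae_of_all _ fun x => ?_))
  rw [Function.comp_apply, SchwartzMap.fourierInv_coe, SchwartzMap.fourier_coe,
    Real.fourierInv_eq_fourier_neg, neg_neg]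

lemma fourierInv_reflectLp (f : Lp ℂ 2 (volume : Measure V)) : 𝓕⁻ (reflectLp f) = 𝓕 f := by
  have h := reflectLp_fourierInv (𝓕 f)
  rw [FourierPair.fourierInv_fourier_eq] at h
  rw [h, FourierPair.fourierInv_fourier_eq]

lemma conj_fourier (f : V → ℂ) (w : V) :
    (starRingEnd ℂ) (𝓕 f w) = 𝓕⁻ (fun x => (starRingEnd ℂ) (f x)) w := by
  rw [Real.fourier_eq', Real.fourierInv_eq', ← integral_conj]
  refine integral_congr_ae (ae_of_all _ fun y => ?_)
  simp [← Complex.exp_conj, Complex.conj_ofNat]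

lemma conjLp_fourier (f : Lp ℂ 2 (volume : Measure V)) :
    conjLp volume (𝓕 f) = 𝓕⁻ (conjLp volume f) := by
  refine congrFun (ext_on_schwartz
    ((conjLp volume).continuous.comp ContinuousFourier.continuous_fourier)
    (ContinuousFourierInv.continuous_fourierInv.comp (conjLp volume).continuous) fun f => ?_) f
  have hconj : conjLp volume (f.toLp 2) = (f.postcompCLM (Complex.conjCLE : ℂ →L[ℝ] ℂ)).toLp 2 :=
    conjLp_toLp _
  rw [Function.comp_apply, Function.comp_apply, hconj, SchwartzMap.toLp_fourier_eq,
    SchwartzMap.toLp_fourierInv_eq]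
  refine (conjLp_toLp _).trans (MemLp.toLp_congr _ _ (ae_of_all _ fun x => ?_))
  rw [Pi.star_apply, SchwartzMap.fourierInv_coe, SchwartzMap.fourier_coe]
  exact conj_fourier f x

lemma conjLp_fourierInv (f : Lp ℂ 2 (volume : Measure V)) :
    conjLp volume (𝓕⁻ f) = 𝓕 (conjLp volume f) := by
  have h := conjLp_fourier (𝓕⁻ f)
  rw [FourierInvPair.fourier_fourierInv_eq] at h
  rw [h, FourierInvPair.fourier_fourierInv_eq]

end Fourier

local notation "L2ℂ" => Lp ℂ 2 (volume : Measure ℝ)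

section Dilation

variable {c : ℝ}

lemma quasiMeasurePreserving_const_mul (hc : c ≠ 0) :
    Measure.QuasiMeasurePreserving (fun x : ℝ => c * x) volume volume := by
  refine ⟨by fun_prop, ?_⟩
  rw [Real.map_volume_mul_left hc]
  exact Measure.smul_absolutelyContinuous

lemma memLp_dilate {f : ℝ → ℂ} (hf : MemLp f 2 volume) (hc : c ≠ 0) :
    MemLp (fun x => (√c : ℂ) * f (c * x)) 2 volume := by
  refine MemLp.const_mul (MemLp.comp_of_map (f := fun x : ℝ => c * x) ?_ (by fun_prop)) _
  rw [Real.map_volume_mul_left hc]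
  exact hf.smul_measure ENNReal.ofReal_ne_top

lemma inner_toLp_dilate {f g : ℝ → ℂ} (hf : MemLp f 2 volume) (hg : MemLp g 2 volume)
    (hc : 0 < c) :
    inner ℂ ((memLp_dilate hf hc.ne').toLp _) ((memLp_dilate hg hc.ne').toLp _) =
      inner ℂ (hf.toLp f) (hg.toLp g) := by
  have hsqrt : (√c : ℂ) * √c = c := by rw [← Complex.ofReal_mul, Real.mul_self_sqrt hc.le]
  have hmul : ∀ x, inner ℂ ((√c : ℂ) * f (c * x)) ((√c : ℂ) * g (c * x)) =
      (c : ℂ) * inner ℂ (f (c * x)) (g (c * x)) := fun x => by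
    simp only [RCLike.inner_apply, map_mul, Complex.conj_ofReal, ← hsqrt]
    ring
  simp only [inner_toLp_toLp, hmul]
  rw [integral_const_mul,
    Measure.integral_comp_mul_left (fun y => inner ℂ (f y) (g y)), abs_of_pos (inv_pos.2 hc),
    ← Complex.real_smul, smul_inv_smul₀ hc.ne']

/-- The unitary dilation `f ↦ √c f(c ·)` on `L²(ℝ)`. -/
def dilateLp (c : ℝ) (hc : 0 < c) : L2ℂ →ₗᵢ[ℂ] L2ℂ :=
  LinearMap.isometryOfInner
    { toFun := fun f => (memLp_dilate (Lp.memLp f) hc.ne').toLp _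
      map_add' := fun f g => by
        rw [← MemLp.toLp_add]
        refine MemLp.toLp_congr _ _ ?_
        filter_upwards [(quasiMeasurePreserving_const_mul hc.ne').ae (Lp.coeFn_add f g)] with x hx
        rw [hx, Pi.add_apply, Pi.add_apply, mul_add]
      map_smul' := fun a f => by
        rw [RingHom.id_apply, ← MemLp.toLp_const_smul]
        refine MemLp.toLp_congr _ _ ?_
        filter_upwards [(quasiMeasurePreserving_const_mul hc.ne').ae (Lp.coeFn_smul a f)] with x hx
        simp only [hx, Pi.smul_apply, smul_eq_mul, mul_left_comm] }
    fun f g => (inner_toLp_dilate (Lp.memLp f) (Lp.memLp g) hc).trans (by simp only [Lp.toLp_coeFn])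

lemma dilateLp_apply (hc : 0 < c) (f : L2ℂ) :
    dilateLp c hc f = (memLp_dilate (Lp.memLp f) hc.ne').toLp _ := rfl

lemma coeFn_dilateLp (hc : 0 < c) (f : L2ℂ) :
    dilateLp c hc f =ᵐ[volume] fun x => (√c : ℂ) * f (c * x) :=
  (memLp_dilate (Lp.memLp f) hc.ne').coeFn_toLp

lemma conjLp_dilateLp (hc : 0 < c) (f : L2ℂ) :
    conjLp volume (dilateLp c hc f) = dilateLp c hc (conjLp volume f) := by
  rw [dilateLp_apply, dilateLp_apply, conjLp_toLp]
  refine MemLp.toLp_congr _ _ ?_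
  filter_upwards [(quasiMeasurePreserving_const_mul hc.ne').ae (coeFn_conjLp f)] with x hx
  simp [hx]

lemma dilateLp_dilateLp_inv (hc : 0 < c) (f : L2ℂ) :
    dilateLp c hc (dilateLp c⁻¹ (inv_pos.2 hc) f) = f := by
  refine Lp.ext ?_
  filter_upwards [coeFn_dilateLp hc (dilateLp c⁻¹ (inv_pos.2 hc) f),
    (quasiMeasurePreserving_const_mul hc.ne').ae (coeFn_dilateLp (inv_pos.2 hc) f)] with x hx₁ hx₂
  rw [hx₁, hx₂, ← mul_assoc, ← Complex.ofReal_mul, ← Real.sqrt_mul hc.le, mul_inv_cancel₀ hc.ne',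
    inv_mul_cancel_left₀ hc.ne', Real.sqrt_one, Complex.ofReal_one, one_mul]

end Dilation

section UnitaryFourier

/-- The unitary transform `f ↦ (2π)^{-1/2} ∫ e^{-isx} f(x) dx` on `L²(ℝ)`. -/
def unitaryFourier : L2ℂ →ₗᵢ[ℂ] L2ℂ :=
  (dilateLp (2 * Real.pi)⁻¹ (inv_pos.2 Real.two_pi_pos)).comp
    (Lp.fourierTransformₗᵢ ℝ ℂ).toLinearIsometry

/-- The inverse of `unitaryFourier`. -/
def unitaryFourierInv : L2ℂ →ₗᵢ[ℂ] L2ℂ :=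
  (Lp.fourierTransformₗᵢ ℝ ℂ).symm.toLinearIsometry.comp (dilateLp (2 * Real.pi) Real.two_pi_pos)

lemma unitaryFourier_apply (f : L2ℂ) :
    unitaryFourier f = dilateLp (2 * Real.pi)⁻¹ (inv_pos.2 Real.two_pi_pos) (𝓕 f) := rfl

lemma unitaryFourierInv_apply (f : L2ℂ) :
    unitaryFourierInv f = 𝓕⁻ (dilateLp (2 * Real.pi) Real.two_pi_pos f) := rfl

lemma unitaryFourierInv_unitaryFourier (f : L2ℂ) : unitaryFourierInv (unitaryFourier f) = f := by
  rw [unitaryFourierInv_apply, unitaryFourier_apply, dilateLp_dilateLp_inv,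
    FourierPair.fourierInv_fourier_eq]

lemma conjLp_unitaryFourier_of_hermitian {f : L2ℂ} (hf : conjLp volume f = reflectLp f) :
    conjLp volume (unitaryFourier f) = unitaryFourier f := by
  rw [unitaryFourier_apply, conjLp_dilateLp, conjLp_fourier, hf, fourierInv_reflectLp]

lemma conjLp_unitaryFourierInv_of_real {f : L2ℂ} (hf : conjLp volume f = f) :
    conjLp volume (unitaryFourierInv f) = reflectLp (unitaryFourierInv f) := by
  rw [unitaryFourierInv_apply, conjLp_fourierInv, reflectLp_fourierInv, conjLp_dilateLp, hf]

lemma invFourierL2_ae_eq {f : ℝ → ℂ} (hf : MemLp f 2 (volume : Measure ℝ)) :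
    invFourierL2 f =ᵐ[volume] unitaryFourier (hf.toLp f) := by
  rw [unitaryFourier_apply]
  filter_upwards [coeFn_dilateLp (inv_pos.2 Real.two_pi_pos) (𝓕 (hf.toLp f))] with s hs
  rw [hs, invFourierL2, dif_pos hf, Real.sqrt_inv, div_eq_inv_mul]

end UnitaryFourier

section FourierKernel

variable {p : ℕ}

/-- The Hermitian symmetry `G(-x) = conj (G(x))` of a matrix-valued function on the line. -/
def IsHermitianKernel (G : ℝ → Matrix (Fin p) (Fin p) ℂ) : Prop :=
  ∀ x i j, G (-x) i j = (starRingEnd ℂ) (G x i j)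

/-- The real part of the entrywise unitary inverse Fourier transform of `G`, which is all of it when
`G` is Hermitian; `maKernel H A t` is the instance `G = harmKernel H A t`. -/
def fourierKernel (G : ℝ → Matrix (Fin p) (Fin p) ℂ) (s : ℝ) : Matrix (Fin p) (Fin p) ℝ :=
  Matrix.of fun i j => (invFourierL2 (fun x => G x i j) s).re

variable {G : ℝ → Matrix (Fin p) (Fin p) ℂ} {i j : Fin p}

lemma conjLp_toLp_of_isHermitianKernel (hG : IsHermitianKernel G)
    (hGm : MemLp (fun x => G x i j) 2 (volume : Measure ℝ)) :
    conjLp volume (hGm.toLp _) = reflectLp (hGm.toLp _) := by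
  rw [conjLp_toLp, reflectLp_toLp]
  exact MemLp.toLp_congr _ _ (ae_of_all _ fun x => (hG x i j).symm)

lemma ofReal_fourierKernel_ae_eq (hG : IsHermitianKernel G)
    (hGm : MemLp (fun x => G x i j) 2 (volume : Measure ℝ)) :
    (fun s => (fourierKernel G s i j : ℂ)) =ᵐ[volume] unitaryFourier (hGm.toLp _) := by
  filter_upwards [invFourierL2_ae_eq hGm, ofReal_re_ae_eq_of_conjLp_eq
    (conjLp_unitaryFourier_of_hermitian (conjLp_toLp_of_isHermitianKernel hG hGm))] with s hs₁ hs₂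
  rw [fourierKernel, Matrix.of_apply, hs₁, hs₂]

lemma memLp_fourierKernel (hGm : MemLp (fun x => G x i j) 2 (volume : Measure ℝ)) :
    MemLp (fun s => fourierKernel G s i j) 2 (volume : Measure ℝ) :=
  ((Lp.memLp _).ae_eq (invFourierL2_ae_eq hGm).symm).re

lemma unitaryFourier_toLp (hG : IsHermitianKernel G)
    (hGm : MemLp (fun x => G x i j) 2 (volume : Measure ℝ)) :
    unitaryFourier (hGm.toLp _) = (memLp_fourierKernel hGm).ofReal.toLp _ :=
  Lp.ext ((ofReal_fourierKernel_ae_eq hG hGm).symm.trans (MemLp.coeFn_toLp _).symm)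

end FourierKernel

section Levy

variable {𝕜 : Type*} [RCLike 𝕜] {p : ℕ} {μ : Measure (EuclideanSpace 𝕜 (Fin p))}

namespace IsLevyL2

-- The measure `‖z‖² μ(dz)` is finite, and `μ` has a density with respect to it off the origin.
lemma sFinite (h : IsLevyL2 μ) : SFinite μ := by
  set w : EuclideanSpace 𝕜 (Fin p) → ℝ≥0∞ := fun z => ‖z‖ₑ ^ 2
  have hw : Measurable w := by fun_prop
  have hw₀ : ∀ᵐ z ∂μ, w z ≠ 0 := by
    filter_upwards [measure_eq_zero_iff_ae_notMem.1 h.zero] with z hz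
    simpa [w] using hz
  have : IsFiniteMeasure (μ.withDensity w) := isFiniteMeasure_withDensity h.secondMoment.ne
  rw [← withDensity_inv_same₀ hw.aemeasurable hw₀ (ae_of_all _ fun z => by simp [w])]
  infer_instance

lemma memLp_id (h : IsLevyL2 μ) : MemLp (fun z => z) 2 μ := by
  refine ⟨measurable_id.aestronglyMeasurable, ?_⟩
  rw [eLpNorm_lt_top_iff_lintegral_rpow_enorm_lt_top (by norm_num) (by norm_num)]
  simpa using h.secondMoment

lemma memLp_clm_apply (h : IsLevyL2 μ) (e : 𝕜 →L[ℝ] ℂ) (i : Fin p) :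
    MemLp (fun z => e (z i)) 2 μ :=
  e.comp_memLp' (h.memLp_id.eval_piLp i)

/-- The function `z ↦ e (zᵢ)` in `L²(μ)`, for a real-linear embedding `e` of the scalars in `ℂ`:
the inclusion of `ℝ`, the identity of `ℂ` or the conjugation. -/
def coordLp (h : IsLevyL2 μ) (e : 𝕜 →L[ℝ] ℂ) (i : Fin p) : Lp ℂ 2 μ :=
  (h.memLp_clm_apply e i).toLp _

lemma inner_coordLp (h : IsLevyL2 μ) (e e' : 𝕜 →L[ℝ] ℂ) (i j : Fin p) :
    inner ℂ (h.coordLp e i) (h.coordLp e' j) = ∫ z, (starRingEnd ℂ) (e (z i)) * e' (z j) ∂μ := by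
  rw [coordLp, coordLp, inner_toLp_toLp]
  simp only [RCLike.inner_apply, mul_comm]

end IsLevyL2

end Levy

section Tensor

variable {α β : Type*} [MeasurableSpace α] [MeasurableSpace β] {κ : Measure α} {μ : Measure β}

lemma memLp_tensor {f : α → ℂ} {h : β → ℂ} (hf : MemLp f 2 κ) (hh : MemLp h 2 μ) :
    MemLp (fun w : α × β => f w.1 * h w.2) 2 (κ.prod μ) := by
  have hm : AEStronglyMeasurable (fun w : α × β => f w.1 * h w.2) (κ.prod μ) :=
    hf.1.comp_fst.mul hh.1.comp_snd
  rw [memLp_two_iff_integrable_sq_norm hm]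
  simpa [mul_pow] using ((memLp_two_iff_integrable_sq_norm hf.1).1 hf).mul_prod
    ((memLp_two_iff_integrable_sq_norm hh.1).1 hh)

variable [SFinite κ] [SFinite μ]

lemma inner_toLp_tensor {f g : α → ℂ} {h k : β → ℂ} (hf : MemLp f 2 κ) (hg : MemLp g 2 κ)
    (hh : MemLp h 2 μ) (hk : MemLp k 2 μ) :
    inner ℂ ((memLp_tensor hf hh).toLp _) ((memLp_tensor hg hk).toLp _) =
      inner ℂ (hf.toLp f) (hg.toLp g) * inner ℂ (hh.toLp h) (hk.toLp k) := by
  rw [inner_toLp_toLp, inner_toLp_toLp, inner_toLp_toLp, ← integral_prod_mul]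
  refine integral_congr_ae (ae_of_all _ fun w => ?_)
  simp only [RCLike.inner_apply, map_mul]
  ring

/-- The operator `f ↦ f ⊗ h` from `L²(κ)` to `L²(κ ⊗ μ)`. -/
def tensorLp (κ : Measure α) [SFinite κ] (h : Lp ℂ 2 μ) : Lp ℂ 2 κ →L[ℂ] Lp ℂ 2 (κ.prod μ) :=
  LinearMap.mkContinuous
    { toFun := fun f => (memLp_tensor (Lp.memLp f) (Lp.memLp h)).toLp _
      map_add' := fun f g => by
        rw [← MemLp.toLp_add]
        refine MemLp.toLp_congr _ _ ?_
        filter_upwards [Measure.quasiMeasurePreserving_fst.ae (Lp.coeFn_add f g)] with w hw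
        rw [hw, Pi.add_apply, Pi.add_apply, add_mul]
      map_smul' := fun a f => by
        rw [RingHom.id_apply, ← MemLp.toLp_const_smul]
        refine MemLp.toLp_congr _ _ ?_
        filter_upwards [Measure.quasiMeasurePreserving_fst.ae (Lp.coeFn_smul a f)] with w hw
        simp only [hw, Pi.smul_apply, smul_eq_mul, mul_assoc] }
    ‖h‖ fun f => by
      refine le_of_sq_le_sq ?_ (by positivity)
      have h := inner_toLp_tensor (Lp.memLp f) (Lp.memLp f) (Lp.memLp h) (Lp.memLp h)
      simp only [Lp.toLp_coeFn, inner_self_eq_norm_sq_to_K] at h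
      rw [mul_pow, mul_comm]
      exact le_of_eq (by exact_mod_cast h)

lemma tensorLp_apply (h : Lp ℂ 2 μ) (f : Lp ℂ 2 κ) :
    tensorLp κ h f = (memLp_tensor (Lp.memLp f) (Lp.memLp h)).toLp _ := rfl

lemma tensorLp_toLp {f : α → ℂ} {h : β → ℂ} (hf : MemLp f 2 κ) (hh : MemLp h 2 μ) :
    tensorLp κ (hh.toLp h) (hf.toLp f) = (memLp_tensor hf hh).toLp _ := by
  rw [tensorLp_apply]
  refine MemLp.toLp_congr _ _ ?_
  filter_upwards [Measure.quasiMeasurePreserving_fst.ae hf.coeFn_toLp,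
    Measure.quasiMeasurePreserving_snd.ae hh.coeFn_toLp] with w hw₁ hw₂
  rw [hw₁, hw₂]

lemma inner_tensorLp (f g : Lp ℂ 2 κ) (h k : Lp ℂ 2 μ) :
    inner ℂ (tensorLp κ h f) (tensorLp κ k g) = inner ℂ f g * inner ℂ h k :=
  (inner_toLp_tensor (Lp.memLp f) (Lp.memLp g) (Lp.memLp h) (Lp.memLp k)).trans
    (by simp only [Lp.toLp_coeFn])

lemma sum_tensorLp_toLp {ι : Type*} [Fintype ι] {f : ι → α → ℂ} {h : ι → β → ℂ}
    (hf : ∀ j, MemLp (f j) 2 κ) (hh : ∀ j, MemLp (h j) 2 μ) :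
    ∑ j, tensorLp κ ((hh j).toLp (h j)) ((hf j).toLp (f j)) =
      (memLp_finsetSum Finset.univ fun j _ => memLp_tensor (hf j) (hh j)).toLp _ := by
  simp only [tensorLp_toLp]
  exact (toLp_finsetSum _ _).symm

lemma conjLp_tensorLp (h : Lp ℂ 2 μ) (f : Lp ℂ 2 κ) :
    conjLp (κ.prod μ) (tensorLp κ h f) = tensorLp κ (conjLp μ h) (conjLp κ f) := by
  rw [tensorLp_apply, tensorLp_apply, conjLp_toLp]
  refine MemLp.toLp_congr _ _ ?_
  filter_upwards [Measure.quasiMeasurePreserving_fst.ae (coeFn_conjLp f),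
    Measure.quasiMeasurePreserving_snd.ae (coeFn_conjLp h)] with w hw₁ hw₂
  rw [hw₁, hw₂, Pi.star_apply, ← map_mul, starRingEnd_apply]

end Tensor

section RealPart

variable {α : Type*} [MeasurableSpace α] {μ : Measure α}

/-- The inclusion of the real `L²` functions in the complex ones. -/
def ofRealLp (μ : Measure α) : Lp ℝ 2 μ →L[ℝ] Lp ℂ 2 μ := Complex.ofRealCLM.compLpL 2 μ

/-- The real part of the complex `L²` functions. -/
def reLp (μ : Measure α) : Lp ℂ 2 μ →L[ℝ] Lp ℝ 2 μ := Complex.reCLM.compLpL 2 μ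

lemma coeFn_ofRealLp (f : Lp ℝ 2 μ) : ofRealLp μ f =ᵐ[μ] fun x => (f x : ℂ) :=
  Complex.ofRealCLM.coeFn_compLpL f

lemma coeFn_reLp (f : Lp ℂ 2 μ) : reLp μ f =ᵐ[μ] fun x => (f x).re :=
  Complex.reCLM.coeFn_compLpL f

lemma inner_ofRealLp (f g : Lp ℝ 2 μ) :
    inner ℂ (ofRealLp μ f) (ofRealLp μ g) = ((inner ℝ f g : ℝ) : ℂ) := by
  rw [L2.inner_def, L2.inner_def, ← integral_complex_ofReal]
  refine integral_congr_ae ?_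
  filter_upwards [coeFn_ofRealLp f, coeFn_ofRealLp g] with x hx₁ hx₂
  simp [hx₁, hx₂]

lemma conjLp_ofRealLp (f : Lp ℝ 2 μ) : conjLp μ (ofRealLp μ f) = ofRealLp μ f := by
  ext1
  filter_upwards [coeFn_conjLp (ofRealLp μ f), coeFn_ofRealLp f] with x hx₁ hx₂
  rw [hx₁, hx₂, Complex.conj_ofReal]

lemma ofRealLp_reLp {f : Lp ℂ 2 μ} (hf : conjLp μ f = f) : ofRealLp μ (reLp μ f) = f := by
  ext1
  filter_upwards [coeFn_ofRealLp (reLp μ f), coeFn_reLp f, ofReal_re_ae_eq_of_conjLp_eq hf]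
    with x hx₁ hx₂ hx₃
  rw [hx₁, hx₂, hx₃]

lemma inner_reLp {f g : Lp ℂ 2 μ} (hf : conjLp μ f = f) (hg : conjLp μ g = g) :
    ((inner ℝ (reLp μ f) (reLp μ g) : ℝ) : ℂ) = inner ℂ f g := by
  rw [← inner_ofRealLp, ofRealLp_reLp hf, ofRealLp_reLp hg]

lemma integral_reLp_eq_zero [IsFiniteMeasure μ] {f : Lp ℂ 2 μ} (hf : ∫ x, f x ∂μ = 0) :
    ∫ x, reLp μ f x ∂μ = 0 := by
  have hre := integral_re ((Lp.memLp f).integrable one_le_two)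
  rw [hf] at hre
  rw [integral_congr_ae (coeFn_reLp f)]
  simpa using hre

end RealPart

section MovingAverage

variable {p : ℕ} {Ω : Type*} [MeasurableSpace Ω] {P : Measure Ω} [IsProbabilityMeasure P]
  {μ : Measure (EuclideanSpace ℝ (Fin p))} {N : Ω → Measure (ℝ × EuclideanSpace ℝ (Fin p))}

lemma inner_coordLp_of_unitSecondMoment (hμ : IsLevyL2 μ) (hI : UnitSecondMoment μ) (i j : Fin p) :
    inner ℂ (hμ.coordLp Complex.ofRealCLM i) (hμ.coordLp Complex.ofRealCLM j) =
      if i = j then (1 : ℂ) else 0 := by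
  have hij : ∫ z, z i * z j ∂μ = (1 : Matrix (Fin p) (Fin p) ℝ) i j := congrFun₂ hI i j
  rw [hμ.inner_coordLp]
  simp only [Complex.ofRealCLM_apply, Complex.conj_ofReal, ← Complex.ofReal_mul]
  rw [integral_complex_ofReal, hij, Matrix.one_apply]
  split_ifs <;> simp

variable [SFinite μ]

/-- The operators `f ↦ ∫ (U f)(s) zᵢ Ñ(ds, dz)`, where `U` is the unitary Fourier transform. -/
def maOperator (h : IsPoissonRandomMeasure N ((volume : Measure ℝ).prod μ) P) (hμ : IsLevyL2 μ)
    (i : Fin p) : Lp ℂ 2 (volume : Measure ℝ) →L[ℂ] Lp ℂ 2 P :=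
  h.integral.toContinuousLinearMap ∘L tensorLp volume (hμ.coordLp Complex.ofRealCLM i) ∘L
    unitaryFourier.toContinuousLinearMap

variable (h : IsPoissonRandomMeasure N ((volume : Measure ℝ).prod μ) P) (hμ : IsLevyL2 μ)

lemma maOperator_apply (i : Fin p) (f : Lp ℂ 2 (volume : Measure ℝ)) :
    maOperator h hμ i f = h.integral (tensorLp volume (hμ.coordLp Complex.ofRealCLM i)
      (unitaryFourier f)) := rfl

lemma isOrthogonalIsometryFamily_maOperator (hI : UnitSecondMoment μ) :
    IsOrthogonalIsometryFamily (maOperator h hμ) := fun i j f g => by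
  rw [maOperator_apply, maOperator_apply, LinearIsometry.inner_map_map, inner_tensorLp,
    inner_coordLp_of_unitSecondMoment hμ hI, LinearIsometry.inner_map_map, mul_ite, mul_one,
    mul_zero]

lemma sum_tensorLp_unitaryFourier {G : ℝ → Matrix (Fin p) (Fin p) ℂ} (hG : IsHermitianKernel G)
    (hGm : ∀ i j, MemLp (fun x => G x i j) 2 (volume : Measure ℝ))
    (hφ : MemLp (fun w : ℝ × EuclideanSpace ℝ (Fin p) => matVec (fourierKernel G w.1) w.2) 2
      ((volume : Measure ℝ).prod μ)) (i : Fin p) :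
    ∑ j, tensorLp volume (hμ.coordLp Complex.ofRealCLM j) (unitaryFourier ((hGm i j).toLp _)) =
      (Complex.ofRealCLM.comp_memLp' (hφ.eval_piLp i)).toLp _ := by
  simp only [unitaryFourier_toLp hG]
  refine (sum_tensorLp_toLp (fun j => (memLp_fourierKernel (hGm i j)).ofReal)
    (hμ.memLp_clm_apply Complex.ofRealCLM)).trans (MemLp.toLp_congr _ _ (ae_of_all _ fun w => ?_))
  simp [matVec, Matrix.mulVec, dotProduct]

theorem ofReal_ae_eq_sum_maOperator {G : ℝ → Matrix (Fin p) (Fin p) ℂ} (hG : IsHermitianKernel G)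
    (hGm : ∀ i j, MemLp (fun x => G x i j) 2 (volume : Measure ℝ))
    {Y : Ω → EuclideanSpace ℝ (Fin p)}
    (hY : IsPoissonIntegral N μ P (fun w => matVec (fourierKernel G w.1) w.2) Y) (i : Fin p) :
    (fun ω => toC (Y ω) i) =ᵐ[P] (∑ j, maOperator h hμ j ((hGm i j).toLp _) : Lp ℂ 2 P) := by
  have hint : h.integral ((Complex.ofRealCLM.comp_memLp' (hY.1.eval_piLp i)).toLp _) =
      (Complex.ofRealCLM.comp_memLp' (hY.2.1.eval_piLp i)).toLp _ :=
    hY.integral_toLp h (Complex.ofRealCLM ∘L EuclideanSpace.proj i)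
  simp only [maOperator_apply]
  rw [← map_sum, sum_tensorLp_unitaryFourier hμ hG hGm hY.1, hint]
  exact (MemLp.coeFn_toLp _).symm

end MovingAverage

section Harmonizable

variable {p : ℕ} {Ω : Type*} [MeasurableSpace Ω] {P : Measure Ω} [IsProbabilityMeasure P]
  {μ : Measure (EuclideanSpace ℂ (Fin p))} {N : Ω → Measure (ℝ × EuclideanSpace ℂ (Fin p))}

local notation "idC" => ContinuousLinearMap.id ℝ ℂ
local notation "conjC" => (Complex.conjCLE : ℂ →L[ℝ] ℂ)

lemma conjLp_coordLp (hμ : IsLevyL2 μ) (i : Fin p) :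
    conjLp μ (hμ.coordLp idC i) = hμ.coordLp conjC i :=
  conjLp_toLp _

/-- The quarter turn `z ↦ iz` changes the sign of `zᵢ zⱼ`. -/
lemma integral_mul_eq_zero_of_rotationInvariant (hr : RotationInvariant μ) (i j : Fin p) :
    ∫ z, z i * z j ∂μ = 0 := by
  have hturn : μ.map (fun z => Complex.I • z) = μ := by
    have hpi := hr (Real.pi / 2) ⟨by linarith [Real.pi_pos], by linarith [Real.pi_pos]⟩
    rwa [mul_comm, Complex.ofReal_div, Complex.ofReal_ofNat, Complex.exp_pi_div_two_mul_I] at hpi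
  have hneg : ∫ z, z i * z j ∂μ = -∫ z, z i * z j ∂μ := by
    conv_lhs => rw [← hturn, integral_map (by fun_prop) (by fun_prop)]
    rw [← integral_neg]
    refine integral_congr_ae (ae_of_all _ fun z => ?_)
    simp only [PiLp.smul_apply, smul_eq_mul]
    linear_combination (z i * z j) * Complex.I_mul_I
  exact self_eq_neg.1 hneg

lemma inner_coordLp_conj_id (hμ : IsLevyL2 μ) (hr : RotationInvariant μ) (i j : Fin p) :
    inner ℂ (hμ.coordLp conjC i) (hμ.coordLp idC j) = 0 := by
  rw [hμ.inner_coordLp]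
  simpa using integral_mul_eq_zero_of_rotationInvariant hr i j

lemma inner_coordLp_add_inner_coordLp (hμ : IsLevyL2 μ) (hI : UnitSecondMomentC μ) (i j : Fin p) :
    inner ℂ (hμ.coordLp idC i) (hμ.coordLp idC j) +
      inner ℂ (hμ.coordLp conjC i) (hμ.coordLp conjC j) = if i = j then (1 : ℂ) else 0 := by
  have hre : 4 * ∫ z, (z i).re * (z j).re ∂μ = (1 : Matrix (Fin p) (Fin p) ℝ) i j :=
    congrFun₂ hI.1 i j
  have him : 4 * ∫ z, (z i).im * (z j).im ∂μ = (1 : Matrix (Fin p) (Fin p) ℝ) i j :=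
    congrFun₂ hI.2 i j
  have hcoord := fun k => hμ.memLp_clm_apply idC k
  have hcoord' := fun k => hμ.memLp_clm_apply conjC k
  have hint_re : Integrable (fun z : EuclideanSpace ℂ (Fin p) => (z i).re * (z j).re) μ :=
    (hcoord i).re.integrable_mul (hcoord j).re
  have hint_im : Integrable (fun z : EuclideanSpace ℂ (Fin p) => (z i).im * (z j).im) μ :=
    (hcoord i).im.integrable_mul (hcoord j).im
  calc inner ℂ (hμ.coordLp idC i) (hμ.coordLp idC j) +
        inner ℂ (hμ.coordLp conjC i) (hμ.coordLp conjC j)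
      = ∫ z, ((2 * ((z i).re * (z j).re) + 2 * ((z i).im * (z j).im) : ℝ) : ℂ) ∂μ := by
        rw [hμ.inner_coordLp, hμ.inner_coordLp]
        refine (integral_add ((hcoord i).star.integrable_mul (hcoord j))
          ((hcoord' i).star.integrable_mul (hcoord' j))).symm.trans
          (integral_congr_ae (ae_of_all _ fun z => Complex.ext ?_ ?_)) <;> simp <;> ring
    _ = ((1 : Matrix (Fin p) (Fin p) ℝ) i j : ℂ) := by
        rw [integral_complex_ofReal, integral_add (hint_re.const_mul 2) (hint_im.const_mul 2),
          integral_const_mul, integral_const_mul]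
        congr 1
        linarith
    _ = if i = j then (1 : ℂ) else 0 := by
        rw [Matrix.one_apply]
        split_ifs <;> simp

variable [SFinite μ]

/-- The operators `f ↦ f ⊗ zᵢ + f(-·) ⊗ z̄ᵢ` from `L²(dx)` to `L²(dx ⊗ μ)`. -/
def symmTensorLp (hμ : IsLevyL2 μ) (i : Fin p) :
    Lp ℂ 2 (volume : Measure ℝ) →L[ℂ] Lp ℂ 2 ((volume : Measure ℝ).prod μ) :=
  tensorLp volume (hμ.coordLp idC i) +
    tensorLp volume (hμ.coordLp conjC i) ∘L reflectLp.toContinuousLinearMap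

lemma symmTensorLp_apply (hμ : IsLevyL2 μ) (i : Fin p) (f : Lp ℂ 2 (volume : Measure ℝ)) :
    symmTensorLp hμ i f = tensorLp volume (hμ.coordLp idC i) f +
      tensorLp volume (hμ.coordLp conjC i) (reflectLp f) := rfl

lemma isOrthogonalIsometryFamily_symmTensorLp (hμ : IsLevyL2 μ) (hI : UnitSecondMomentC μ)
    (hr : RotationInvariant μ) : IsOrthogonalIsometryFamily (symmTensorLp hμ) := fun i j f g => by
  have hcross : inner ℂ (hμ.coordLp idC i) (hμ.coordLp conjC j) = 0 := by
    rw [← inner_conj_symm, inner_coordLp_conj_id hμ hr, map_zero]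
  simp only [symmTensorLp_apply, inner_add_left, inner_add_right, inner_tensorLp, hcross,
    inner_coordLp_conj_id hμ hr, LinearIsometry.inner_map_map, mul_zero, add_zero, zero_add]
  rw [← mul_add, inner_coordLp_add_inner_coordLp hμ hI, mul_ite, mul_one, mul_zero]

lemma conjLp_symmTensorLp (hμ : IsLevyL2 μ) (i : Fin p) {f : Lp ℂ 2 (volume : Measure ℝ)}
    (hf : conjLp volume f = reflectLp f) :
    conjLp _ (symmTensorLp hμ i f) = symmTensorLp hμ i f := by
  rw [symmTensorLp_apply, map_add, conjLp_tensorLp, conjLp_tensorLp, ← conjLp_coordLp, ← hf,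
    conjLp_conjLp, conjLp_conjLp, add_comm]

lemma sum_symmTensorLp (hμ : IsLevyL2 μ) {G : ℝ → Matrix (Fin p) (Fin p) ℂ}
    (hGm : ∀ i j, MemLp (fun x => G x i j) 2 (volume : Measure ℝ))
    (hφ : MemLp (fun w : ℝ × EuclideanSpace ℂ (Fin p) =>
      matVec (G w.1) w.2 + matVec (G (-w.1)) (conjVec w.2)) 2 ((volume : Measure ℝ).prod μ))
    (i : Fin p) :
    ∑ j, symmTensorLp hμ j ((hGm i j).toLp _) = (hφ.eval_piLp i).toLp _ := by
  simp only [symmTensorLp_apply, reflectLp_toLp, Finset.sum_add_distrib]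
  refine (congrArg₂ _ (sum_tensorLp_toLp (hGm i) (hμ.memLp_clm_apply idC))
    (sum_tensorLp_toLp (fun j => (hGm i j).comp_measurePreserving
      (Measure.measurePreserving_neg volume)) (hμ.memLp_clm_apply conjC))).trans ?_
  rw [← MemLp.toLp_add]
  refine MemLp.toLp_congr _ _ (ae_of_all _ fun w => ?_)
  simp [matVec, Matrix.mulVec, dotProduct, conjVec]

/-- The operators `f ↦ ∫ ((V f)(x) zᵢ + (V f)(-x) z̄ᵢ) Ñ(dx, dz)`, where `V` is the inverse of the
unitary Fourier transform. -/
def realHarmOperator (h : IsPoissonRandomMeasure N ((volume : Measure ℝ).prod μ) P)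
    (hμ : IsLevyL2 μ) (i : Fin p) : Lp ℝ 2 (volume : Measure ℝ) →L[ℝ] Lp ℝ 2 P :=
  reLp P ∘L (h.integral.toContinuousLinearMap ∘L symmTensorLp hμ i ∘L
    unitaryFourierInv.toContinuousLinearMap).restrictScalars ℝ ∘L ofRealLp volume

variable (h : IsPoissonRandomMeasure N ((volume : Measure ℝ).prod μ) P) (hμ : IsLevyL2 μ)

lemma realHarmOperator_apply (i : Fin p) (f : Lp ℝ 2 (volume : Measure ℝ)) :
    realHarmOperator h hμ i f =
      reLp P (h.integral (symmTensorLp hμ i (unitaryFourierInv (ofRealLp volume f)))) := rfl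

lemma isOrthogonalIsometryFamily_realHarmOperator (hI : UnitSecondMomentC μ)
    (hr : RotationInvariant μ) : IsOrthogonalIsometryFamily (realHarmOperator h hμ) :=
  fun i j f g => by
  have hreal : ∀ i (f : Lp ℝ 2 (volume : Measure ℝ)), conjLp P
      (h.integral (symmTensorLp hμ i (unitaryFourierInv (ofRealLp volume f)))) =
        h.integral (symmTensorLp hμ i (unitaryFourierInv (ofRealLp volume f))) := fun i f => by
    rw [h.conjLp_integral, conjLp_symmTensorLp hμ i
      (conjLp_unitaryFourierInv_of_real (conjLp_ofRealLp f))]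
  apply Complex.ofReal_injective
  rw [realHarmOperator_apply, realHarmOperator_apply, inner_reLp (hreal i f) (hreal j g),
    LinearIsometry.inner_map_map, isOrthogonalIsometryFamily_symmTensorLp hμ hI hr,
    LinearIsometry.inner_map_map, inner_ofRealLp]
  split_ifs <;> simp

lemma integral_realHarmOperator_eq_zero (i : Fin p) (f : Lp ℝ 2 (volume : Measure ℝ)) :
    ∫ ω, realHarmOperator h hμ i f ω ∂P = 0 :=
  integral_reLp_eq_zero (h.integral_integral_eq_zero _)

lemma unitaryFourierInv_ofRealLp_fourierKernel {G : ℝ → Matrix (Fin p) (Fin p) ℂ}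
    (hG : IsHermitianKernel G) {i j : Fin p}
    (hGm : MemLp (fun x => G x i j) 2 (volume : Measure ℝ)) :
    unitaryFourierInv (ofRealLp volume ((memLp_fourierKernel hGm).toLp _)) = hGm.toLp _ := by
  rw [ofRealLp, compLpL_toLp, ← unitaryFourierInv_unitaryFourier (hGm.toLp _),
    unitaryFourier_toLp hG]
  rfl

theorem ae_eq_sum_realHarmOperator {G : ℝ → Matrix (Fin p) (Fin p) ℂ} (hG : IsHermitianKernel G)
    (hGm : ∀ i j, MemLp (fun x => G x i j) 2 (volume : Measure ℝ))
    {X : Ω → EuclideanSpace ℝ (Fin p)}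
    (hX : IsPoissonIntegral N μ P (fun w => matVec (G w.1) w.2 + matVec (G (-w.1)) (conjVec w.2))
      (fun ω => toC (X ω))) (i : Fin p) :
    (fun ω => X ω i) =ᵐ[P]
      (∑ j, realHarmOperator h hμ j ((memLp_fourierKernel (hGm i j)).toLp _) : Lp ℝ 2 P) := by
  have hint : h.integral ((hX.1.eval_piLp i).toLp _) = (hX.2.1.eval_piLp i).toLp _ :=
    hX.integral_toLp h ((EuclideanSpace.proj i).restrictScalars ℝ)
  have hsum : ∑ j, symmTensorLp hμ j (unitaryFourierInv
      (ofRealLp volume ((memLp_fourierKernel (hGm i j)).toLp _))) =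
        (hX.1.eval_piLp i).toLp _ :=
    (Finset.sum_congr rfl fun j _ => congrArg (symmTensorLp hμ j)
      (unitaryFourierInv_ofRealLp_fourierKernel hG (hGm i j))).trans
        (sum_symmTensorLp hμ hGm hX.1 i)
  simp only [realHarmOperator_apply]
  rw [← map_sum, ← map_sum, hsum, hint, reLp, compLpL_toLp]
  exact (MemLp.coeFn_toLp _).symm

end Harmonizable

section ExponentialGrowth

variable {𝔸 : Type*} [NormedRing 𝔸] [NormedAlgebra ℂ 𝔸] [CompleteSpace 𝔸]

lemma exists_norm_pow_le_of_spectralRadius_lt {a : 𝔸} {r : ℝ} (hr : 0 < r)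
    (ha : spectralRadius ℂ a < ENNReal.ofReal r) : ∃ C : ℝ, ∀ n : ℕ, ‖a ^ n‖ ≤ C * r ^ n := by
  have hlim := spectrum.pow_norm_pow_one_div_tendsto_nhds_spectralRadius a
  have hev : ∀ᶠ n : ℕ in atTop, ‖a ^ n‖ ≤ 1 * ‖r ^ n‖ := by
    filter_upwards [hlim.eventually_lt_const ha, eventually_gt_atTop 0] with n hn hn0
    have hroot : ‖a ^ n‖ ^ (1 / n : ℝ) ≤ r := (ENNReal.ofReal_lt_ofReal_iff hr).1 hn |>.le
    rwa [one_div, Real.rpow_inv_le_iff_of_pos (norm_nonneg _) hr.le (by positivity),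
      Real.rpow_natCast, ← one_mul (r ^ n), ← Real.norm_of_nonneg (pow_nonneg hr.le n)] at hroot
  obtain ⟨C, -, hC⟩ := Asymptotics.bound_of_isBigO_nat_atTop (Asymptotics.IsBigO.of_bound 1 hev)
  refine ⟨C, fun n => ?_⟩
  simpa only [Real.norm_of_nonneg (pow_nonneg hr.le n)] using hC (pow_pos hr n).ne'

lemma exists_norm_exp_smul_le_of_spectralRadius_lt {a : 𝔸} {c : ℝ}
    (ha : spectralRadius ℂ (NormedSpace.exp a) < ENNReal.ofReal (Real.exp c)) :
    ∃ C : ℝ, ∀ s : ℝ, 0 ≤ s → ‖NormedSpace.exp ((s : ℂ) • a)‖ ≤ C * Real.exp (c * s) := by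
  let : NormedAlgebra ℚ 𝔸 := NormedAlgebra.restrictScalars ℚ ℂ _
  obtain ⟨C₁, hC₁⟩ := exists_norm_pow_le_of_spectralRadius_lt (Real.exp_pos c) ha
  obtain ⟨C₂, hC₂⟩ := (isCompact_Icc (a := (0 : ℝ)) (b := 1)).exists_bound_of_continuousOn
    (f := fun r : ℝ => Real.exp (-(c * r)) * ‖NormedSpace.exp ((r : ℂ) • a)‖)
    (by fun_prop)
  refine ⟨C₁ * C₂, fun s hs => ?_⟩
  set n := ⌊s⌋₊
  set r := s - n
  have hr : r ∈ Set.Icc (0 : ℝ) 1 :=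
    ⟨sub_nonneg.2 (Nat.floor_le hs), by linarith [(Nat.lt_floor_add_one s).le]⟩
  have hexp_r : ‖NormedSpace.exp ((r : ℂ) • a)‖ ≤ C₂ * Real.exp (c * r) := by
    have hbound := (Real.le_norm_self _).trans (hC₂ r hr)
    rwa [Real.exp_neg, inv_mul_le_iff₀ (Real.exp_pos _), mul_comm] at hbound
  have hsplit : NormedSpace.exp ((s : ℂ) • a) =
      NormedSpace.exp a ^ n * NormedSpace.exp ((r : ℂ) • a) := by
    rw [← NormedSpace.exp_nsmul, ← NormedSpace.exp_add_of_commute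
      (((Commute.refl a).smul_right _).smul_left _), ← Nat.cast_smul_eq_nsmul ℂ, ← add_smul]
    simp [r]
  calc ‖NormedSpace.exp ((s : ℂ) • a)‖
      ≤ ‖NormedSpace.exp a ^ n‖ * ‖NormedSpace.exp ((r : ℂ) • a)‖ := hsplit ▸ norm_mul_le _ _
    _ ≤ C₁ * Real.exp c ^ n * (C₂ * Real.exp (c * r)) :=
        mul_le_mul (hC₁ n) hexp_r (norm_nonneg _) ((norm_nonneg _).trans (hC₁ n))
    _ = C₁ * C₂ * Real.exp (c * s) := by
        rw [← Real.exp_nat_mul, show c * s = n * c + c * r by simp [r]; ring, Real.exp_add]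
        ring

end ExponentialGrowth

section MatrixExponential

attribute [local instance] Matrix.linftyOpNormedRing Matrix.linftyOpNormedAlgebra

variable {n : Type*} [Fintype n] [DecidableEq n]

lemma exp_mulVec_of_mulVec_eq_smul {M : Matrix n n ℂ} {z : ℂ} {v : n → ℂ} (hv : M *ᵥ v = z • v) :
    NormedSpace.exp M *ᵥ v = Complex.exp z • v := by
  have hpow : ∀ k : ℕ, M ^ k *ᵥ v = z ^ k • v := fun k => by
    induction k with
    | zero => simp
    | succ k ih => rw [pow_succ', ← Matrix.mulVec_mulVec, ih, Matrix.mulVec_smul, hv, smul_smul,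
        pow_succ]
  have hsum_M : HasSum (fun k : ℕ => ((k.factorial : ℂ)⁻¹ • M ^ k) *ᵥ v)
      (NormedSpace.exp M *ᵥ v) :=
    (NormedSpace.exp_series_hasSum_exp' (𝕂 := ℂ) M).map (Matrix.mulVec.addMonoidHomLeft v)
      (show Continuous fun X : Matrix n n ℂ => X *ᵥ v by fun_prop)
  have hsum_z := (NormedSpace.exp_series_hasSum_exp' (𝕂 := ℂ) z).smul_const v
  rw [← Complex.exp_eq_exp_ℂ] at hsum_z
  refine hsum_M.unique ?_
  simpa only [Matrix.smul_mulVec, hpow, smul_smul, smul_eq_mul] using hsum_z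

-- The eigenspaces of `exp M` are invariant under `M`, which therefore has an eigenvector there.
lemma exists_exp_eq_of_mem_spectrum_exp {M : Matrix n n ℂ} {w : ℂ}
    (hw : w ∈ spectrum ℂ (NormedSpace.exp M)) : ∃ z ∈ spectrum ℂ M, Complex.exp z = w := by
  set E := Module.End.eigenspace (Matrix.toLin' (NormedSpace.exp M)) w
  have hcomm : Commute (NormedSpace.exp M) M := (Commute.refl M).exp_left
  have hE : Set.MapsTo (Matrix.toLin' M) E E :=
    Module.End.mapsTo_genEigenspace_of_comm (hcomm.map Matrix.toLinAlgEquiv') w 1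
  rw [← Matrix.spectrum_toLin', ← Module.End.hasEigenvalue_iff_mem_spectrum] at hw
  have : Nontrivial E := Submodule.nontrivial_iff_ne_bot.2 hw
  obtain ⟨z, hz⟩ := Module.End.exists_eigenvalue ((Matrix.toLin' M).restrict hE)
  obtain ⟨v, hv⟩ := hz.exists_hasEigenvector
  have hMv : M *ᵥ v = z • (v : n → ℂ) := congrArg Subtype.val hv.apply_eq_smul
  have hv0 : (v : n → ℂ) ≠ 0 := fun h => hv.2 (Subtype.ext h)
  refine ⟨z, ?_, smul_left_injective ℂ hv0 ?_⟩
  · rw [← Matrix.spectrum_toLin', ← Module.End.hasEigenvalue_iff_mem_spectrum]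
    exact Module.End.hasEigenvalue_of_hasEigenvector
      (Module.End.hasEigenvector_iff.2 ⟨Module.End.mem_eigenspace_iff.2 (by simpa using hMv), hv0⟩)
  · simpa [exp_mulVec_of_mulVec_eq_smul hMv] using Module.End.mem_eigenspace_iff.1 v.2

lemma exists_norm_exp_smul_le_of_spectrum_re_lt [Nonempty n] {M : Matrix n n ℂ} {c : ℝ}
    (hM : ∀ z ∈ spectrum ℂ M, z.re < c) :
    ∃ C : ℝ, ∀ s : ℝ, 0 ≤ s → ‖NormedSpace.exp ((s : ℂ) • M)‖ ≤ C * Real.exp (c * s) := by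
  refine exists_norm_exp_smul_le_of_spectralRadius_lt
    (spectrum.spectralRadius_lt_of_forall_lt _ fun w hw => ?_)
  obtain ⟨z, hz, rfl⟩ := exists_exp_eq_of_mem_spectrum_exp hw
  rw [← NNReal.coe_lt_coe, coe_nnnorm, Complex.norm_exp, Real.coe_toNNReal _ (Real.exp_pos c).le]
  exact Real.exp_lt_exp.2 (hM z hz)

lemma norm_apply_le_linfty_opNorm (M : Matrix n n ℂ) (i j : n) : ‖M i j‖ ≤ ‖M‖ :=
  calc ‖M i j‖ ≤ ∑ k, ‖M i k‖ :=
        Finset.single_le_sum (f := fun k => ‖M i k‖) (fun _ _ => norm_nonneg _) (Finset.mem_univ j)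
    _ = ‖WithLp.toLp 1 (M i)‖ := by simp [PiLp.norm_eq_of_L1]
    _ ≤ ‖M‖ := norm_le_pi_norm (fun i => WithLp.toLp 1 (M i)) i

lemma map_ofReal_exp_smul (M : Matrix n n ℝ) (s : ℝ) :
    (NormedSpace.exp (s • M)).map Complex.ofReal =
      NormedSpace.exp ((s : ℂ) • M.map Complex.ofReal) := by
  let : NormedAlgebra ℚ (Matrix n n ℝ) := NormedAlgebra.restrictScalars ℚ ℝ _
  refine (NormedSpace.map_exp (Complex.ofRealHom.mapMatrix (m := n))
    (continuous_id.matrix_map Complex.continuous_ofReal) (s • M)).trans (congrArg _ ?_)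
  ext i j
  simp

lemma exists_abs_exp_smul_apply_le {M : Matrix n n ℝ} {c : ℝ}
    (hM : ∀ z ∈ spectrum ℂ (M.map Complex.ofReal), z.re < c) :
    ∃ C : ℝ, ∀ s : ℝ, 0 ≤ s → ∀ i j, |NormedSpace.exp (s • M) i j| ≤ C * Real.exp (c * s) := by
  cases isEmpty_or_nonempty n
  · exact ⟨0, fun s _ i => isEmptyElim i⟩
  obtain ⟨C, hC⟩ := exists_norm_exp_smul_le_of_spectrum_re_lt hM
  refine ⟨C, fun s hs i j => ?_⟩
  calc |NormedSpace.exp (s • M) i j|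
      = ‖NormedSpace.exp ((s : ℂ) • M.map Complex.ofReal) i j‖ := by
        rw [← map_ofReal_exp_smul, Matrix.map_apply, Complex.norm_real, Real.norm_eq_abs]
    _ ≤ C * Real.exp (c * s) := (norm_apply_le_linfty_opNorm _ i j).trans (hC s hs)

lemma continuous_exp_smul_apply (M : Matrix n n ℝ) (i j : n) :
    Continuous fun s : ℝ => NormedSpace.exp (s • M) i j := by
  let : NormedAlgebra ℚ (Matrix n n ℝ) := NormedAlgebra.restrictScalars ℚ ℝ _
  exact (NormedSpace.exp_continuous.comp (by fun_prop : Continuous fun s : ℝ => s • M)).matrix_elem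
    i j

end MatrixExponential

section PowerBounds

variable {E : Type*} [NormedAddCommGroup E]

lemma integrable_of_even_of_integrableOn_Ioi {f : ℝ → E} (heven : ∀ x, f (-x) = f x)
    (hf : IntegrableOn f (Set.Ioi 0)) : Integrable f := by
  have hIio : IntegrableOn f (Set.Iio 0) := by
    have hcomp := ((Measure.measurePreserving_neg (volume : Measure ℝ)).integrableOn_comp_preimage
      (Homeomorph.neg ℝ).measurableEmbedding).2 hf
    rw [show Neg.neg ⁻¹' Set.Ioi (0 : ℝ) = Set.Iio 0 by ext; simp] at hcomp
    exact hcomp.congr_fun (fun x _ => heven x) measurableSet_Iio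
  rw [← integrableOn_univ, ← Set.Iio_union_Ici (a := (0 : ℝ))]
  exact hIio.union ((integrableOn_Ici_iff_integrableOn_Ioi (by simp)).2 hf)

lemma integrableOn_sq_norm_of_norm_le_rpow {g : ℝ → E} {s : Set ℝ} {C a : ℝ}
    (hg : AEStronglyMeasurable g (volume.restrict s)) (hs : MeasurableSet s)
    (hs0 : s ⊆ Set.Ioi 0) (hint : IntegrableOn (fun x : ℝ => x ^ (2 * a)) s)
    (hbound : ∀ x ∈ s, ‖g x‖ ≤ C * x ^ a) : IntegrableOn (fun x => ‖g x‖ ^ 2) s := by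
  refine (hint.const_mul (C ^ 2)).mono' (hg.norm.pow 2) ?_
  filter_upwards [ae_restrict_mem hs] with x hx
  calc ‖‖g x‖ ^ 2‖ = ‖g x‖ ^ 2 := Real.norm_of_nonneg (sq_nonneg _)
    _ ≤ (C * x ^ a) ^ 2 := pow_le_pow_left₀ (norm_nonneg _) (hbound x hx) 2
    _ = C ^ 2 * x ^ (2 * a) := by
      rw [mul_pow, mul_comm 2 a, Real.rpow_mul (hs0 hx).le, Real.rpow_two]

lemma memLp_two_of_norm_le_rpow {g : ℝ → E} {C₀ C₁ a b : ℝ}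
    (hg : AEStronglyMeasurable g volume) (heven : ∀ x, ‖g (-x)‖ = ‖g x‖)
    (ha : -1 / 2 < a) (hb : b < -1 / 2) (h₀ : ∀ x ∈ Set.Ioc 0 1, ‖g x‖ ≤ C₀ * x ^ a)
    (h₁ : ∀ x ∈ Set.Ioi 1, ‖g x‖ ≤ C₁ * x ^ b) : MemLp g 2 volume := by
  have hsmall : IntegrableOn (fun x : ℝ => x ^ (2 * a)) (Set.Ioc 0 1) := by
    rw [← intervalIntegrable_iff_integrableOn_Ioc_of_le zero_le_one]
    exact intervalIntegral.intervalIntegrable_rpow' (by linarith)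
  have hlarge : IntegrableOn (fun x : ℝ => x ^ (2 * b)) (Set.Ioi 1) :=
    integrableOn_Ioi_rpow_of_lt (by linarith) one_pos
  rw [memLp_two_iff_integrable_sq_norm hg]
  refine integrable_of_even_of_integrableOn_Ioi (fun x => by rw [heven]) ?_
  rw [← Set.Ioc_union_Ioi_eq_Ioi zero_le_one]
  exact (integrableOn_sq_norm_of_norm_le_rpow hg.restrict measurableSet_Ioc
      Set.Ioc_subset_Ioi_self hsmall h₀).union
    (integrableOn_sq_norm_of_norm_le_rpow hg.restrict measurableSet_Ioi
      (Set.Ioi_subset_Ioi zero_le_one) hlarge h₁)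

end PowerBounds

section HarmonizableKernel

variable {p : ℕ}

lemma exists_lt_forall_spectrum_re_lt {n : Type*} [Fintype n] [DecidableEq n] {M : Matrix n n ℂ}
    {r : ℝ} (hM : ∀ z ∈ spectrum ℂ M, z.re < r) : ∃ c < r, ∀ z ∈ spectrum ℂ M, z.re < c := by
  have hfin : (spectrum ℂ M).Finite := by
    rw [← Matrix.spectrum_toLin']
    exact Module.End.finite_spectrum _
  have hev : ∀ᶠ c in 𝓝[<] r, ∀ z ∈ spectrum ℂ M, z.re < c :=
    (eventually_all_finite hfin).2 fun z hz => mem_nhdsWithin_of_mem_nhds (Ioi_mem_nhds (hM z hz))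
  exact ((eventually_mem_nhdsWithin (a := r) (s := Set.Iio r)).and hev).exists

lemma posPow_of_pos {x : ℝ} (hx : 0 < x) (M : Matrix (Fin p) (Fin p) ℝ) :
    posPow x M = NormedSpace.exp (Real.log x • M) := if_pos hx

lemma exists_abs_posPow_apply_le_of_one_le {M : Matrix (Fin p) (Fin p) ℝ} {r : ℝ}
    (hM : ∀ z ∈ spectrum ℂ (M.map Complex.ofReal), z.re < r) :
    ∃ c < r, ∃ C : ℝ, ∀ x : ℝ, 1 ≤ x → ∀ i j, |posPow x M i j| ≤ C * x ^ c := by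
  obtain ⟨c, hcr, hc⟩ := exists_lt_forall_spectrum_re_lt hM
  obtain ⟨C, hC⟩ := exists_abs_exp_smul_apply_le hc
  refine ⟨c, hcr, C, fun x hx i j => ?_⟩
  have hx0 : 0 < x := one_pos.trans_le hx
  rw [posPow_of_pos hx0, Real.rpow_def_of_pos hx0, mul_comm _ c]
  exact hC _ (Real.log_nonneg hx) i j

lemma exists_abs_posPow_apply_le_of_le_one {M : Matrix (Fin p) (Fin p) ℝ} {r : ℝ}
    (hM : ∀ z ∈ spectrum ℂ (M.map Complex.ofReal), r < z.re) :
    ∃ c > r, ∃ C : ℝ, ∀ x ∈ Set.Ioc (0 : ℝ) 1, ∀ i j, |posPow x M i j| ≤ C * x ^ c := by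
  have hneg : ∀ z ∈ spectrum ℂ ((-M).map Complex.ofReal), z.re < -r := fun z hz => by
    rw [show (-M).map Complex.ofReal = -M.map Complex.ofReal by ext; simp, ← spectrum.neg_eq] at hz
    simpa using lt_neg.1 (hM _ hz)
  obtain ⟨c, hcr, C, hC⟩ := exists_abs_posPow_apply_le_of_one_le hneg
  refine ⟨-c, lt_neg.1 hcr, C, fun x hx i j => ?_⟩
  have hinv := hC x⁻¹ (one_le_inv_iff₀.2 hx) i j
  rwa [posPow_of_pos (inv_pos.2 hx.1), Real.log_inv, smul_neg, neg_smul, neg_neg,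
    ← posPow_of_pos hx.1, Real.inv_rpow hx.1.le, ← Real.rpow_neg hx.1.le] at hinv

lemma measurable_posPow_apply (M : Matrix (Fin p) (Fin p) ℝ) (i j : Fin p) :
    Measurable fun x : ℝ => posPow x M i j := by
  simp only [posPow, apply_ite (fun X : Matrix (Fin p) (Fin p) ℝ => X i j)]
  exact Measurable.ite measurableSet_Ioi
    ((continuous_exp_smul_apply M i j).measurable.comp Real.measurable_log) measurable_const

variable {H : Matrix (Fin p) (Fin p) ℝ}

lemma re_mem_Ioo_of_mem_spectrum_neg_sub_half (hH : reEig H ⊆ Set.Ioo 0 1) {z : ℂ}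
    (hz : z ∈ spectrum ℂ ((-(H - (1 / 2 : ℝ) • 1)).map Complex.ofReal)) :
    z.re ∈ Set.Ioo (-1 / 2) (1 / 2) := by
  have hshift : (-(H - (1 / 2 : ℝ) • 1)).map Complex.ofReal =
      algebraMap ℂ (Matrix (Fin p) (Fin p) ℂ) (1 / 2) - H.map Complex.ofReal := by
    ext i j
    by_cases hij : i = j <;> simp [hij, Matrix.algebraMap_matrix_apply]
  rw [hshift, ← spectrum.singleton_sub_eq] at hz
  obtain ⟨_, rfl, w, hw, rfl⟩ := hz
  have hw01 := hH ⟨w, hw, rfl⟩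
  norm_num
  constructor <;> linarith [hw01.1, hw01.2]

lemma norm_exp_sub_one_div_le (t x : ℝ) :
    ‖(Complex.exp (Complex.I * t * x) - 1) / (Complex.I * x)‖ ≤ |t| := by
  rw [norm_div, mul_assoc, ← Complex.ofReal_mul, norm_mul, Complex.norm_I, one_mul,
    Complex.norm_real]
  refine div_le_of_le_mul₀ (norm_nonneg _) (abs_nonneg _)
    (Real.norm_exp_I_mul_ofReal_sub_one_le.trans_eq (norm_mul t x))

lemma norm_exp_sub_one_div_le_two_div (t x : ℝ) :
    ‖(Complex.exp (Complex.I * t * x) - 1) / (Complex.I * x)‖ ≤ 2 / |x| := by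
  rw [norm_div, mul_assoc, ← Complex.ofReal_mul, norm_mul, Complex.norm_I, one_mul,
    Complex.norm_real, Real.norm_eq_abs]
  refine div_le_div_of_nonneg_right ((norm_sub_le _ _).trans_eq ?_) (abs_nonneg x)
  rw [Complex.norm_exp_I_mul_ofReal, norm_one, one_add_one_eq_two]

variable (H) (A : Matrix (Fin p) (Fin p) ℂ) (t : ℝ)

lemma isHermitianKernel_harmKernel : IsHermitianKernel (harmKernel H A t) := fun x i j => by
  have hfactor : (starRingEnd ℂ) ((Complex.exp (Complex.I * t * x) - 1) / (Complex.I * x)) =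
      (Complex.exp (Complex.I * t * (-x : ℝ)) - 1) / (Complex.I * (-x : ℝ)) := by
    rw [map_div₀, map_sub, ← Complex.exp_conj]
    simp
  simp only [harmKernel, Matrix.smul_apply, Matrix.add_apply, Matrix.mul_apply, Matrix.map_apply,
    smul_eq_mul, map_mul, map_add, map_sum, Complex.conj_ofReal, Complex.conj_conj, hfactor,
    neg_neg]
  rw [add_comm]

lemma measurable_harmKernel_apply (i j : Fin p) : Measurable fun x => harmKernel H A t x i j := by
  simp only [harmKernel, Matrix.smul_apply, Matrix.add_apply, Matrix.mul_apply, Matrix.map_apply,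
    smul_eq_mul]
  have hpow := measurable_posPow_apply (-(H - (1 / 2 : ℝ) • 1))
  refine Measurable.mul (by fun_prop) (Measurable.add ?_ ?_) <;>
    refine Finset.measurable_sum _ fun k _ => (Complex.measurable_ofReal.comp ?_).mul_const _
  exacts [hpow i k, (hpow i k).comp measurable_neg]

variable {H}

lemma norm_harmKernel_apply_le {x B K : ℝ} (hx : 0 < x) (i j : Fin p)
    (hK : ‖(Complex.exp (Complex.I * t * x) - 1) / (Complex.I * x)‖ ≤ K)
    (hB : ∀ k, |posPow x (-(H - (1 / 2 : ℝ) • 1)) i k| ≤ B) :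
    ‖harmKernel H A t x i j‖ ≤ K * (B * ∑ k, ‖A k j‖) := by
  have hneg : posPow (-x) (-(H - (1 / 2 : ℝ) • 1)) = 0 := if_neg (by linarith)
  have hentry : harmKernel H A t x i j = (Complex.exp (Complex.I * t * x) - 1) / (Complex.I * x) *
      ∑ k, (posPow x (-(H - (1 / 2 : ℝ) • 1)) i k : ℂ) * A k j := by
    rw [harmKernel, hneg]
    simp [Matrix.mul_apply]
  have hsum : ‖∑ k, (posPow x (-(H - (1 / 2 : ℝ) • 1)) i k : ℂ) * A k j‖ ≤ B * ∑ k, ‖A k j‖ := by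
    rw [Finset.mul_sum]
    refine norm_sum_le_of_le _ fun k _ => ?_
    rw [norm_mul, Complex.norm_real]
    exact mul_le_mul_of_nonneg_right (hB k) (norm_nonneg _)
  rw [hentry, norm_mul]
  exact mul_le_mul hK hsum (norm_nonneg _) ((norm_nonneg _).trans hK)

theorem memLp_harmKernel (hH : reEig H ⊆ Set.Ioo 0 1) (i j : Fin p) :
    MemLp (fun x => harmKernel H A t x i j) 2 (volume : Measure ℝ) := by
  obtain ⟨a, ha, C₀, hC₀⟩ := exists_abs_posPow_apply_le_of_le_one
    fun z hz => (re_mem_Ioo_of_mem_spectrum_neg_sub_half hH hz).1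
  obtain ⟨b, hb, C₁, hC₁⟩ := exists_abs_posPow_apply_le_of_one_le
    fun z hz => (re_mem_Ioo_of_mem_spectrum_neg_sub_half hH hz).2
  refine memLp_two_of_norm_le_rpow (C₀ := |t| * C₀ * ∑ k, ‖A k j‖) (C₁ := 2 * C₁ * ∑ k, ‖A k j‖)
    (a := a) (b := b - 1) (measurable_harmKernel_apply H A t i j).aestronglyMeasurable
    (fun x => by rw [isHermitianKernel_harmKernel, RCLike.norm_conj]) ha (by linarith)
    (fun x hx => ?_) (fun x hx => ?_)
  · exact (norm_harmKernel_apply_le A t hx.1 i j (norm_exp_sub_one_div_le t x)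
      fun k => hC₀ x hx i k).trans_eq (by ring)
  · have hx0 : 0 < x := one_pos.trans hx
    refine (norm_harmKernel_apply_le A t hx0 i j (norm_exp_sub_one_div_le_two_div t x)
      fun k => hC₁ x (Set.mem_Ioi.1 hx).le i k).trans_eq ?_
    rw [abs_of_pos hx0, Real.rpow_sub_one hx0.ne']
    ring

end HarmonizableKernel

lemma measurable_toC {p : ℕ} :
    Measurable (toC : EuclideanSpace ℝ (Fin p) → EuclideanSpace ℂ (Fin p)) := by
  unfold toC
  fun_prop

end OfLm

end

theorem propositionp_general {p : ℕ} {G : ℝ → ℝ → Matrix (Fin p) (Fin p) ℂ}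
    (hG : ∀ t, OfLm.IsHermitianKernel (G t))
    (hGm : ∀ t i j, MemLp (fun x => G t x i j) 2 (volume : Measure ℝ)) :
    (∀ {Ω Ω₀ : Type*} [MeasurableSpace Ω] [MeasurableSpace Ω₀]
        (P : Measure Ω) (P₀ : Measure Ω₀) [IsProbabilityMeasure P₀]
        (μ : Measure (EuclideanSpace ℝ (Fin p)))
        (N : Ω₀ → Measure (ℝ × EuclideanSpace ℝ (Fin p)))
        (X : ℝ → Ω → EuclideanSpace ℝ (Fin p)) (Y : ℝ → Ω₀ → EuclideanSpace ℝ (Fin p)),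
      OfLm.IsLevyL2 μ → OfLm.IsPoissonRandomMeasure N ((volume : Measure ℝ).prod μ) P₀ →
      (∀ t, OfLm.IsPoissonIntegral N μ P₀
        (fun w => OfLm.matVec (OfLm.fourierKernel (G t) w.1) w.2) (Y t)) →
      OfLm.FddEq X P Y P₀ → OfLm.UnitSecondMoment μ →
      ∃ (Φ : Set ℝ → Ω₀ → EuclideanSpace ℂ (Fin p)) (Z : ℝ → Ω₀ → EuclideanSpace ℂ (Fin p)),
        OfLm.IsOrthogonalRandomMeasure Φ P₀ ∧
        (∀ t, OfLm.IsOrthIntegral Φ P₀ (G t) (Z t)) ∧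
        OfLm.FddEq (fun t ω => OfLm.toC (X t ω)) P Z P₀) ∧
    (∀ {Ω : Type*} [MeasurableSpace Ω] (P : Measure Ω) [IsProbabilityMeasure P]
        (μ : Measure (EuclideanSpace ℂ (Fin p)))
        (N : Ω → Measure (ℝ × EuclideanSpace ℂ (Fin p)))
        (X : ℝ → Ω → EuclideanSpace ℝ (Fin p)),
      OfLm.IsLevyL2 μ → OfLm.IsPoissonRandomMeasure N ((volume : Measure ℝ).prod μ) P →
      (∀ t, OfLm.IsPoissonIntegral N μ P (fun w => OfLm.matVec (G t w.1) w.2 +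
        OfLm.matVec (G t (-w.1)) (OfLm.conjVec w.2)) (fun ω => OfLm.toC (X t ω))) →
      OfLm.UnitSecondMomentC μ → OfLm.RotationInvariant μ →
      ∃ (Φ : Set ℝ → Ω → EuclideanSpace ℝ (Fin p)) (Z : ℝ → Ω → EuclideanSpace ℝ (Fin p)),
        OfLm.IsOrthogonalRandomMeasure Φ P ∧
        (∀ t, OfLm.IsOrthIntegral Φ P (OfLm.fourierKernel (G t)) (Z t)) ∧
        OfLm.FddEq X P Z P) := by
  refine ⟨fun P P₀ _ μ N X Y hμ h hY hXY hI => ?_, fun P _ μ N X hμ h hX hI hr => ?_⟩ <;>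
    have := hμ.sFinite
  · refine ⟨OfLm.orthMeasure (OfLm.maOperator h hμ), fun t ω => OfLm.toC (Y t ω),
      OfLm.isOrthogonalRandomMeasure_orthMeasure
        (OfLm.isOrthogonalIsometryFamily_maOperator h hμ hI)
        fun i f => h.integral_integral_eq_zero _,
      fun t => OfLm.isOrthIntegral_orthMeasure (hGm t)
        (OfLm.ofReal_ae_eq_sum_maOperator h hμ (hG t) (hGm t) (hY t)), fun n t => ?_⟩
    exact (hXY n t).comp (u := fun x i => OfLm.toC (x i))
      (measurable_pi_lambda _ fun i => OfLm.measurable_toC.comp (measurable_pi_apply i))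
  · have hint := fun t => OfLm.isOrthIntegral_orthMeasure
      (fun i j => OfLm.memLp_fourierKernel (hGm t i j))
      (OfLm.ae_eq_sum_realHarmOperator h hμ (hG t) (hGm t) (hX t))
    exact ⟨OfLm.orthMeasure (OfLm.realHarmOperator h hμ), X,
      OfLm.isOrthogonalRandomMeasure_orthMeasure
        (OfLm.isOrthogonalIsometryFamily_realHarmOperator h hμ hI hr)
        (OfLm.integral_realHarmOperator_eq_zero h hμ), hint, fun n t =>
      IdentDistrib.refl (aemeasurable_pi_lambda _ fun i => (hint (t i)).2.1.aemeasurable)⟩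

theorem propositionp {p : ℕ} (H : Matrix (Fin p) (Fin p) ℝ)
    (hH : OfLm.reEig H ⊆ Set.Ioo 0 1 \ {1 / 2}) (A : Matrix (Fin p) (Fin p) ℂ) :
    (∀ {Ω Ω₀ : Type*} [MeasurableSpace Ω] [MeasurableSpace Ω₀]
        (P : Measure Ω) [IsProbabilityMeasure P] (P₀ : Measure Ω₀) [IsProbabilityMeasure P₀]
        (μ : Measure (EuclideanSpace ℝ (Fin p)))
        (N : Ω₀ → Measure (ℝ × EuclideanSpace ℝ (Fin p)))
        (X : ℝ → Ω → EuclideanSpace ℝ (Fin p)),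
      OfLm.IsMaofLm H A μ N P₀ X P → OfLm.UnitSecondMoment μ →
      ∃ (Φ : Set ℝ → Ω₀ → EuclideanSpace ℂ (Fin p)) (Y : ℝ → Ω₀ → EuclideanSpace ℂ (Fin p)),
        OfLm.IsOrthogonalRandomMeasure Φ P₀ ∧
        (∀ t, OfLm.IsOrthIntegral Φ P₀ (OfLm.harmKernel H A t) (Y t)) ∧
        OfLm.FddEq (fun t ω => OfLm.toC (X t ω)) P Y P₀) ∧
    (∀ {Ω : Type*} [MeasurableSpace Ω] (P : Measure Ω) [IsProbabilityMeasure P]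
        (μ : Measure (EuclideanSpace ℂ (Fin p)))
        (N : Ω → Measure (ℝ × EuclideanSpace ℂ (Fin p)))
        (X : ℝ → Ω → EuclideanSpace ℝ (Fin p)),
      OfLm.IsRhofLm H A μ N X P → OfLm.UnitSecondMomentC μ → OfLm.RotationInvariant μ →
      ∃ (Φ : Set ℝ → Ω → EuclideanSpace ℝ (Fin p)) (Y : ℝ → Ω → EuclideanSpace ℝ (Fin p)),
        OfLm.IsOrthogonalRandomMeasure Φ P ∧
        (∀ t, OfLm.IsOrthIntegral Φ P (OfLm.maKernel H A t) (Y t)) ∧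
        OfLm.FddEq X P Y P) := by
  have hmemLp := fun t => OfLm.memLp_harmKernel A t (hH.trans Set.sdiff_subset)
  obtain ⟨hma, hharm⟩ :=
    propositionp_general (OfLm.isHermitianKernel_harmKernel H A) hmemLp
  refine ⟨fun P _ P₀ _ μ N X hX hI => ?_, fun P _ μ N X hX => ?_⟩
  · obtain ⟨Y, hY, hXY⟩ := hX.repr
    exact hma P P₀ μ N X Y hX.levy hX.poisson hY hXY hI
  · exact hharm P μ N X hX.levy hX.poisson hX.repr
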